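/- Let $A,B\in M_N(\mathbb C)$ be PQ-matrices (each is a permutation matrix times a diagonal matrix) with $2A^*A+B^*B=I$ and $A$ nonsingular. Consider the lazy nearest neighbor open quantum walk $\Phi$ on the sites $0,1,2,\dots$ with absorbing boundary at $0$: from each site the walk stays with transition matrix $B$ and moves to either neighbor with transition matrix $A$ (from $0$ the move to the left is lost), so that $\Phi\big(\sum_i\rho_i\otimes|i\rangle\langle i|\big)=\sum_j\big(B\rho_jB^*+A\rho_{j+1}A^*+A\rho_{j-1}A^*\big)\otimes|j\rangle\langle j|$ with $\rho_{-1}=0$. Its block matrix is $$\widehat T=\begin{bmatrix}[B]&[A]&&\\ [A]&[B]&[A]&\\ &[A]&[B]&\ddots\\ &&\ddots&\ddots\end{bmatrix},\qquad [A]=A\otimes\overline A,\quad [B]=B\otimes\overline B .$$ The real part of $A$ is its trace-relevant part, that is, the real matrix $P_A=(|a_{kl}|^2)_{k,l}$ formed by the entries of $[A]$ in the rows $(k,k)$ and columns $(l,l)$; $P_B$ is defined likewise. Assume that $P_A$ and $P_B$ are symmetric. Let $U_0(x)=I$, $U_{-1}(x)=0$ and $xU_m(x)=P_AU_{m+1}(x)+P_BU_m(x)+P_AU_{m-1}(x)$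 for $m\ge 0$. Then there exists a matrix measure $W$ on $\mathbb R$ (a real $N\times N$ matrix of finite signed Borel measures that is symmetric positive semidefinite on every Borel set), with finite moments of all orders, such that: 1. the polynomials $U_m$ are orthonormal with respect to $W$: $\int U_i(x)\,dW(x)\,U_j(x)^T=\delta_{ij}I$ for all $i,j\ge0$; 2. for every density matrix $\rho$ and all $i,j,t\ge 0$, the probability that the walk started at $\rho\otimes|i\rangle\langle i|$ is at site $j$ after $t$ steps is the sum of the entries of the vector $\Big(\int x^tU_j(x)\,dW(x)\,U_i(x)^T\Big)(\rho_{11},\dots,\rho_{NN})^T$; 3. the measure is given explicitly by Durán's formula when the latter applies. For $K$ real symmetric positive definite and $B'$ real symmetric, put $H_{K,B'}(x)=K^{-1/2}(B'-xI)K^{-1}(B'-xI)K^{-1/2}-4I$, diagonalize $-H_{K,B'}(x)=V(x)D(x)V(x)^*$ with $V(x)$ unitary and $D(x)$ diagonal, and let $$w_{K,B'}(x)=\frac1{2\pi}K^{-1/2}V(x)D^+(x)^{1/2}V(x)^*K^{-1/2},$$ where $D^+(x)$ is the diagonal matrix with entries $\max\{d_{kk}(x),0\}$. If $P_A$ is positive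 definite, then $dW(x)=w_{P_A,P_B}(x)\,dx$. If $N\le 2$ or $P_AP_B=P_BP_A$, then $dW(x)=w_{|P_A|,P_B}(x)\,dx$, where $|P_A|=(P_A^2)^{1/2}$. -/

import Mathlib

open MeasureTheory Matrix Polynomial
open scoped Kronecker ComplexOrder

set_option linter.unusedSectionVars false

noncomputable section

namespace LazyOQW

variable {n : Type*} [Fintype n] [DecidableEq n]

/-! ### Open quantum walks on the half-line -/

/-- One step of the open quantum walk on the sites `0, 1, 2, …` with transition matrices
`K i j` (from site `i` to site `j`). A state `∑ j, ρ j ⊗ |j⟩⟨j|` is recorded as the sequence of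
its site components `ρ j`; the new component at `j` is `∑ i, K i j * ρ i * (K i j)ᴴ`. -/
def step (K : ℕ → ℕ → Matrix n n ℂ) (ρ : ℕ → Matrix n n ℂ) : ℕ → Matrix n n ℂ :=
  fun j => ∑' i, K i j * ρ i * (K i j)ᴴ

/-- The probability (as a complex number) of being at site `j` after `t` steps, starting from
`ρ ⊗ |i⟩⟨i|`. -/
def transitionProb (K : ℕ → ℕ → Matrix n n ℂ) (ρ : Matrix n n ℂ) (i j t : ℕ) : ℂ :=
  ((step K)^[t] (Pi.single i ρ) j).trace

/-- The transition matrices of the lazy walk on the half-line: stay with `B`, move to either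
neighbour with `A`. At site `0` the left move is lost (absorbing boundary). -/
def lazyTransition (A B : Matrix n n ℂ) (i j : ℕ) : Matrix n n ℂ :=
  if i = j then B else if i + 1 = j ∨ j + 1 = i then A else 0

/-- The matrix representation `[A] = A ⊗ conj A` of the conjugation map `X ↦ A X Aᴴ`, acting on
`vec X` (rows stacked, so that `vec X` is indexed by pairs). -/
def rep (A : Matrix n n ℂ) : Matrix (n × n) (n × n) ℂ :=
  A ⊗ₖ A.map (starRingEnd ℂ)

/-- `rep A` is the matrix of the conjugation map. -/
theorem rep_mulVec (A X : Matrix n n ℂ) :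
    rep A *ᵥ (fun p : n × n => X p.1 p.2) = fun p => (A * X * Aᴴ) p.1 p.2 := by
  ext ⟨i, j⟩
  simp only [rep, Matrix.mulVec, dotProduct, Matrix.kroneckerMap_apply, Matrix.map_apply,
    Fintype.sum_prod_type, Matrix.mul_apply, Matrix.conjTranspose_apply, Finset.sum_mul]
  rw [Finset.sum_comm]
  refine Finset.sum_congr rfl fun l _ => Finset.sum_congr rfl fun k _ => ?_
  rw [starRingEnd_apply]
  ring

/-- A PQ-matrix: a permutation matrix times a diagonal matrix. -/
def IsPQ (A : Matrix n n ℂ) : Prop :=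
  ∃ (σ : Equiv.Perm n) (d : n → ℂ), A = σ.permMatrix ℂ * Matrix.diagonal d

/-- The real part (trace-relevant part) of `A`: the entries of `[A]` whose row and column both
belong to diagonal entries of a density. -/
def realPart (A : Matrix n n ℂ) : Matrix n n ℝ :=
  Matrix.of fun i j => (rep A (i, i) (j, j)).re

theorem rep_diag (A : Matrix n n ℂ) (i j : n) :
    rep A (i, i) (j, j) = ((‖A i j‖ ^ 2 : ℝ) : ℂ) := by
  simp [rep, Matrix.kroneckerMap_apply, Complex.mul_conj, Complex.normSq_eq_norm_sq]

theorem realPart_apply (A : Matrix n n ℂ) (i j : n) : realPart A i j = ‖A i j‖ ^ 2 := by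
  rw [realPart, Matrix.of_apply, rep_diag, Complex.ofReal_re]

/-! ### Matrix polynomials -/

/-- Evaluation of a matrix of polynomials at a point. -/
def evalAt (P : Matrix n n ℝ[X]) (x : ℝ) : Matrix n n ℝ :=
  P.map (Polynomial.eval x)

/-- The matrix polynomials `U 0 = I`, `x U k = A U (k+1) + B U k + A U (k-1)`, `U (-1) = 0`,
for nonsingular `A`. -/
def chebU (A B : Matrix n n ℝ) : ℕ → Matrix n n ℝ[X]
  | 0 => 1
  | 1 => A⁻¹.map C * ((X : ℝ[X]) • (1 : Matrix n n ℝ[X]) - B.map C)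
  | k + 2 => A⁻¹.map C *
      (((X : ℝ[X]) • (1 : Matrix n n ℝ[X]) - B.map C) * chebU A B (k + 1)
        - A.map C * chebU A B k)

theorem map_C_mul_inv {A : Matrix n n ℝ} (hA : IsUnit A.det) (M : Matrix n n ℝ[X]) :
    A.map C * (A⁻¹.map C * M) = M := by
  rw [← Matrix.mul_assoc, ← Matrix.map_mul, Matrix.mul_nonsing_inv A hA]
  simp

theorem chebU_rec_zero {A : Matrix n n ℝ} (B : Matrix n n ℝ) (hA : IsUnit A.det) :
    (X : ℝ[X]) • chebU A B 0 = A.map C * chebU A B 1 + B.map C * chebU A B 0 := by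
  simp only [chebU]
  rw [map_C_mul_inv hA]
  simp

theorem chebU_rec_succ {A : Matrix n n ℝ} (B : Matrix n n ℝ) (hA : IsUnit A.det) (k : ℕ) :
    (X : ℝ[X]) • chebU A B (k + 1) =
      A.map C * chebU A B (k + 2) + B.map C * chebU A B (k + 1) + A.map C * chebU A B k := by
  conv_rhs => rw [chebU]
  rw [map_C_mul_inv hA, sub_mul, smul_mul_assoc, one_mul]
  abel

/-! ### Matrix measures -/

/-- A matrix measure on the real line: a matrix of finite signed Borel measures whose value on
every Borel set is a (symmetric) positive semidefinite matrix. -/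
structure MatrixMeasure (n : Type*) [Fintype n] where
  entry : n → n → SignedMeasure ℝ
  posSemidef : ∀ s, MeasurableSet s → (Matrix.of fun a b => entry a b s).PosSemidef

/-- All moments of the matrix measure are finite. -/
def MatrixMeasure.HasFiniteMoments (W : MatrixMeasure n) : Prop :=
  ∀ (a b : n) (k : ℕ), (W.entry a b).Integrable fun x : ℝ => x ^ k

/-- The matrix `∫ f(x) P(x) dW(x) Q(x)ᵀ`. -/
def MatrixMeasure.integral (W : MatrixMeasure n) (f : ℝ[X]) (P Q : Matrix n n ℝ[X]) :
    Matrix n n ℝ :=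
  Matrix.of fun a b => ∑ k, ∑ l,
    ∫ᵛ x, (f.eval x * evalAt P x a k * evalAt Q x b l) ∂•(W.entry k l)

/-- `dW = w(x) dx`. -/
def MatrixMeasure.HasDensity (W : MatrixMeasure n) (w : ℝ → Matrix n n ℝ) : Prop :=
  ∀ a b, Integrable (fun x => w x a b) ∧
    ∀ s, MeasurableSet s → W.entry a b s = ∫ x in s, w x a b

/-! ### The explicit weight -/

/-- `A ^ (-1/2)` for a positive definite `A`. -/
def invSqrt (A : Matrix n n ℝ) : Matrix n n ℝ :=
  cfc (fun t : ℝ => (Real.sqrt t)⁻¹) A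

/-- `H(x) = A^(-1/2) (B - x I) A⁻¹ (B - x I) A^(-1/2) - 4 I`. -/
def duranH (A B : Matrix n n ℝ) (x : ℝ) : Matrix n n ℝ :=
  invSqrt A * (B - x • (1 : Matrix n n ℝ)) * A⁻¹ * (B - x • (1 : Matrix n n ℝ)) * invSqrt A
    - (4 : ℝ) • (1 : Matrix n n ℝ)

/-- The weight `(1/2π) A^(-1/2) V(x) D⁺(x)^(1/2) V(x)* A^(-1/2)`, where `-H(x) = V(x) D(x) V(x)*`
with `V(x)` unitary and `D(x)` diagonal, and `D⁺` is the entrywise positive part of `D`. The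
product `V D⁺^(1/2) V*` is the function `t ↦ √(max t 0)` of the hermitian matrix `-H(x)`. -/
def duranWeight (A B : Matrix n n ℝ) (x : ℝ) : Matrix n n ℝ :=
  (1 / (2 * Real.pi)) •
    (invSqrt A * cfc (fun t : ℝ => Real.sqrt (max t 0)) (-(duranH A B x)) * invSqrt A)

/-- The absolute value `|A| = (A²)^(1/2)` of a symmetric matrix. -/
def absMat (A : Matrix n n ℝ) : Matrix n n ℝ :=
  cfc (fun t : ℝ => |t|) A

end LazyOQW

end

/-!
The walk acts on the diagonals of the densities alone: for a PQ-matrix `K` the diagonal of `K ρ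
Kᴴ` is `P_K` applied to the diagonal of `ρ` (`IsPQ.diag_conj`). Hence the transition probabilities
are governed by the blocks of the powers of the block Jacobi matrix `T` with `P_B` on the diagonal
and `P_A` beside it; `jacobiPow P_A P_B t j i` is the block `(j, i)` of `T ^ t`, defined by
recursion.

A matrix measure whose `t`-th moment is the block `(0, 0)` of `T ^ t` for all `t` satisfies `∫ x ^
t U_j dW U_iᵀ = (T ^ t)_{ji}`, because the three-term recursion of the `U_j` and the recursion of
the powers of `T` agree (`MatrixMeasure.HasFiniteMoments.integral_chebU`). The case `t = 0` is
orthonormality, and the general case is the formula for the probabilities. So only the moments of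
`W` matter.

For arbitrary symmetric coefficients such a `W` exists by compactness
(`exists_matrixMeasure_of_isSymm`): the spectral measures of the finite truncations of `T`, at
vectors supported at site `0`, live on a common compact interval, have the correct moments up to
the size of the truncation, and are quadratic in the vector. All of this passes to a limit along
an ultrafilter, and polarization gives the entries of `W`.

For the explicit weight the normalization is decisive. A symmetric `P_A` is a weighted involution,
so that `P_A ^ 2` is the square of the diagonal matrix of column sums, and likewise for `P_B`;
since the column sums `a`, `b` satisfy `2 a + b = 1`, one gets `|P_A| = (I - |P_B|) / 2`, a
function `φ(P_B)` (`absMat_realPart_eq_cfc`). If `P_A` is positive definite, or `N ≤ 2`, then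
`P_A` commutes with `P_B`. When they commute, the sign `J` of `P_A` is an involution commuting
with `P_B`, and its powers conjugate `T` to the block Jacobi matrix of `φ(P_B)` and `P_B`, which
splits into scalar ones over the eigenvalues of `P_B` (`jacobiPow_of_commute`). The scalar
orthogonality measure is a semicircle law, with centre `β` and radius `2 φ(β)`, by the
orthogonality of the Chebyshev polynomials of the second kind (`semicircleMoment_zero`), and its
density is the value at `β` of the explicit weight (`duranWeight_cfc`).
-/

noncomputable section

namespace LazyOQW

variable {n : Type*} [Fintype n] [DecidableEq n]

/-! ### Powers of a block Jacobi matrix -/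

/-- The block at position `(j, i)` of the `t`-th power of the semi-infinite block tridiagonal
matrix with `B` on the diagonal and `A` on both neighbouring diagonals. -/
def jacobiPow (A B : Matrix n n ℝ) : ℕ → ℕ → ℕ → Matrix n n ℝ
  | 0, j, i => if j = i then 1 else 0
  | t + 1, 0, i => A * jacobiPow A B t 1 i + B * jacobiPow A B t 0 i
  | t + 1, j + 1, i =>
      A * jacobiPow A B t (j + 2) i + B * jacobiPow A B t (j + 1) i + A * jacobiPow A B t j i

/-- The recursion from the right: `T ^ (t + 1) = T ^ t * T` instead of `T * T ^ t`. -/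
theorem jacobiPow_succ_right_zero (A B : Matrix n n ℝ) (t j : ℕ) :
    jacobiPow A B (t + 1) j 0 = jacobiPow A B t j 1 * A + jacobiPow A B t j 0 * B := by
  induction t generalizing j with
  | zero =>
    rcases j with _ | _ | j <;> simp [jacobiPow]
  | succ t ih =>
    rcases j with _ | j
    · conv_lhs => rw [jacobiPow, ih, ih]
      conv_rhs => rw [jacobiPow, jacobiPow]
      noncomm_ring
    · conv_lhs => rw [jacobiPow, ih, ih, ih]
      conv_rhs => rw [jacobiPow, jacobiPow]
      noncomm_ring

theorem jacobiPow_succ_right_succ (A B : Matrix n n ℝ) (t j i : ℕ) :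
    jacobiPow A B (t + 1) j (i + 1) =
      jacobiPow A B t j (i + 2) * A + jacobiPow A B t j (i + 1) * B + jacobiPow A B t j i * A := by
  induction t generalizing j with
  | zero =>
    rcases j with _ | j
    · rcases i with _ | i <;> simp [jacobiPow]
    · simp only [jacobiPow, add_left_inj, Nat.reduceEqDiff]
      simp only [mul_ite, ite_mul, mul_one, one_mul, mul_zero, zero_mul]
      abel
  | succ t ih =>
    rcases j with _ | j
    · conv_lhs => rw [jacobiPow, ih, ih]
      conv_rhs => rw [jacobiPow, jacobiPow, jacobiPow]
      noncomm_ring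
    · conv_lhs => rw [jacobiPow, ih, ih, ih]
      conv_rhs => rw [jacobiPow, jacobiPow, jacobiPow]
      noncomm_ring

/-! ### Integration against a matrix measure -/

namespace MatrixMeasure

/-- The linear functional `p ↦ ∫ p dW_{kl}` on polynomials. -/
def moment (W : MatrixMeasure n) (k l : n) (p : ℝ[X]) : ℝ :=
  ∫ᵛ x, p.eval x ∂•(W.entry k l)

variable {W : MatrixMeasure n}

theorem HasFiniteMoments.integrable_eval (hW : W.HasFiniteMoments) (k l : n) (p : ℝ[X]) :
    (W.entry k l).Integrable fun x => p.eval x := by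
  have : (fun x => p.eval x) =
      fun x => ∑ i ∈ Finset.range (p.natDegree + 1), p.coeff i • x ^ i := by
    funext x
    rw [eval_eq_sum_range]
    simp
  rw [this]
  exact integrable_finsetSum _ fun i _ => MeasureTheory.Integrable.smul (p.coeff i) (hW k l i)

theorem HasFiniteMoments.moment_add (hW : W.HasFiniteMoments) (k l : n) (p q : ℝ[X]) :
    W.moment k l (p + q) = W.moment k l p + W.moment k l q := by
  simp only [moment, eval_add]
  exact VectorMeasure.integral_fun_add (hW.integrable_eval k l p) (hW.integrable_eval k l q)

theorem moment_C_mul (W : MatrixMeasure n) (k l : n) (c : ℝ) (p : ℝ[X]) :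
    W.moment k l (C c * p) = c * W.moment k l p := by
  simp only [moment, eval_mul, eval_C]
  exact VectorMeasure.integral_fun_smul _ _ c _

theorem HasFiniteMoments.moment_sum (hW : W.HasFiniteMoments) (k l : n) {ι : Type*}
    (s : Finset ι) (p : ι → ℝ[X]) :
    W.moment k l (∑ i ∈ s, p i) = ∑ i ∈ s, W.moment k l (p i) := by
  simp only [moment, eval_finsetSum]
  exact VectorMeasure.integral_finsetSum _ fun i _ => hW.integrable_eval k l (p i)

theorem integral_apply (W : MatrixMeasure n) (f : ℝ[X]) (P Q : Matrix n n ℝ[X]) (a b : n) :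
    W.integral f P Q a b = ∑ k, ∑ l, W.moment k l (f * P a k * Q b l) := by
  simp [integral, moment, evalAt]

theorem HasFiniteMoments.integral_add_left (hW : W.HasFiniteMoments) (f : ℝ[X])
    (P P' Q : Matrix n n ℝ[X]) :
    W.integral f (P + P') Q = W.integral f P Q + W.integral f P' Q := by
  ext a b
  simp only [integral_apply, Matrix.add_apply, mul_add, add_mul, hW.moment_add,
    Finset.sum_add_distrib]

theorem HasFiniteMoments.integral_add_right (hW : W.HasFiniteMoments) (f : ℝ[X])
    (P Q Q' : Matrix n n ℝ[X]) :
    W.integral f P (Q + Q') = W.integral f P Q + W.integral f P Q' := by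
  ext a b
  simp only [integral_apply, Matrix.add_apply, mul_add, hW.moment_add, Finset.sum_add_distrib]

theorem HasFiniteMoments.integral_map_C_mul_left (hW : W.HasFiniteMoments) (f : ℝ[X])
    (A : Matrix n n ℝ) (P Q : Matrix n n ℝ[X]) :
    W.integral f (A.map C * P) Q = A * W.integral f P Q := by
  ext a b
  have h : ∀ k l, W.moment k l (f * (A.map C * P) a k * Q b l) =
      ∑ m, A a m * W.moment k l (f * P m k * Q b l) := fun k l => by
    simp only [Matrix.mul_apply, Matrix.map_apply, Finset.mul_sum, Finset.sum_mul, hW.moment_sum]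
    refine Finset.sum_congr rfl fun m _ => ?_
    rw [← moment_C_mul]
    congr 1
    ring
  rw [integral_apply, Matrix.mul_apply]
  simp only [h, integral_apply, Finset.mul_sum]
  conv_lhs => enter [2, k]; rw [Finset.sum_comm]
  exact Finset.sum_comm

theorem HasFiniteMoments.integral_map_C_mul_right (hW : W.HasFiniteMoments) (f : ℝ[X])
    (A : Matrix n n ℝ) (P Q : Matrix n n ℝ[X]) :
    W.integral f P (A.map C * Q) = W.integral f P Q * Aᵀ := by
  ext a b
  have h : ∀ k l, W.moment k l (f * P a k * (A.map C * Q) b l) =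
      ∑ m, W.moment k l (f * P a k * Q m l) * A b m := fun k l => by
    simp only [Matrix.mul_apply, Matrix.map_apply, Finset.mul_sum, hW.moment_sum]
    refine Finset.sum_congr rfl fun m _ => ?_
    rw [mul_comm (W.moment k l _), ← moment_C_mul]
    congr 1
    ring
  rw [integral_apply, Matrix.mul_apply]
  simp only [h, integral_apply, Finset.sum_mul, Matrix.transpose_apply]
  conv_lhs => enter [2, k]; rw [Finset.sum_comm]
  exact Finset.sum_comm

theorem integral_X_smul_left (W : MatrixMeasure n) (f : ℝ[X]) (P Q : Matrix n n ℝ[X]) :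
    W.integral f ((X : ℝ[X]) • P) Q = W.integral (f * X) P Q := by
  ext a b
  simp only [integral_apply, Matrix.smul_apply, smul_eq_mul]
  simp only [mul_assoc]

theorem integral_X_smul_right (W : MatrixMeasure n) (f : ℝ[X]) (P Q : Matrix n n ℝ[X]) :
    W.integral f P ((X : ℝ[X]) • Q) = W.integral (f * X) P Q := by
  ext a b
  simp only [integral_apply, Matrix.smul_apply, smul_eq_mul]
  refine Finset.sum_congr rfl fun k _ => Finset.sum_congr rfl fun l _ => ?_
  congr 1
  ring

/-- If the moments of `W` are the `(0, 0)` blocks of the powers of the block Jacobi matrix, then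
`∫ x ^ t U_j dW U_i ^ T` is its block `(j, i)`. Both sides obey the same recursions in `j` and in
`i`, and these determine them from the blocks `(0, 0)`, as `A` is invertible. -/
theorem HasFiniteMoments.integral_chebU (hW : W.HasFiniteMoments) {A B : Matrix n n ℝ}
    (hA : IsUnit A.det) (hAs : A.IsSymm) (hBs : B.IsSymm)
    (hmom : ∀ t, W.integral (X ^ t) 1 1 = jacobiPow A B t 0 0) (t j i : ℕ) :
    W.integral (X ^ t) (chebU A B j) (chebU A B i) = jacobiPow A B t j i := by
  have hl : ∀ M M' : Matrix n n ℝ, A * M = A * M' → M = M' := fun M M' h => by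
    rw [← Matrix.nonsing_inv_mul_cancel_left (A := A) M hA, h,
      Matrix.nonsing_inv_mul_cancel_left (A := A) M' hA]
  have hr : ∀ M M' : Matrix n n ℝ, M * A = M' * A → M = M' := fun M M' h => by
    rw [← Matrix.mul_nonsing_inv_cancel_right (A := A) M hA, h,
      Matrix.mul_nonsing_inv_cancel_right (A := A) M' hA]
  have h0 : ∀ j t, W.integral (X ^ t) (chebU A B j) 1 = jacobiPow A B t j 0 := fun j => by
    induction j using Nat.strong_induction_on with
    | _ j ih =>
      intro t
      rcases j with _ | _ | j
      · simpa [chebU] using hmom t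
      · have h := W.integral_X_smul_left (X ^ t) (chebU A B 0) 1
        rw [chebU_rec_zero B hA, hW.integral_add_left, hW.integral_map_C_mul_left,
          hW.integral_map_C_mul_left, ← pow_succ, ih 0 (by simp), ih 0 (by simp), jacobiPow] at h
        exact hl _ _ (add_right_cancel h)
      · have h := W.integral_X_smul_left (X ^ t) (chebU A B (j + 1)) 1
        rw [chebU_rec_succ B hA, hW.integral_add_left, hW.integral_add_left,
          hW.integral_map_C_mul_left, hW.integral_map_C_mul_left, hW.integral_map_C_mul_left,
          ← pow_succ, ih (j + 1) (by simp), ih (j + 1) (by simp), ih j (by omega),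
          jacobiPow] at h
        exact hl _ _ (add_right_cancel (add_right_cancel h))
  induction i using Nat.strong_induction_on generalizing t with
  | _ i ih =>
    rcases i with _ | _ | i
    · simpa [chebU] using h0 j t
    · have h := W.integral_X_smul_right (X ^ t) (chebU A B j) (chebU A B 0)
      rw [chebU_rec_zero B hA, hW.integral_add_right, hW.integral_map_C_mul_right,
        hW.integral_map_C_mul_right, ← pow_succ, ih 0 (by simp), ih 0 (by simp),
        jacobiPow_succ_right_zero, hAs, hBs] at h
      exact hr _ _ (add_right_cancel h)
    · have h := W.integral_X_smul_right (X ^ t) (chebU A B j) (chebU A B (i + 1))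
      rw [chebU_rec_succ B hA, hW.integral_add_right, hW.integral_add_right,
        hW.integral_map_C_mul_right, hW.integral_map_C_mul_right, hW.integral_map_C_mul_right,
        ← pow_succ, ih (i + 1) (by simp), ih (i + 1) (by simp), ih i (by omega),
        jacobiPow_succ_right_succ, hAs, hBs] at h
      exact hr _ _ (add_right_cancel (add_right_cancel h))

end MatrixMeasure

/-! ### The walk on the diagonals of the densities -/

theorem permMatrix_mul_diagonal_apply (σ : Equiv.Perm n) (d : n → ℂ) (k l : n) :
    (σ.permMatrix ℂ * diagonal d) k l = if l = σ k then d (σ k) else 0 := by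
  rw [Matrix.mul_diagonal, Equiv.Perm.permMatrix, PEquiv.toMatrix_apply]
  by_cases hl : l = σ k
  · simp [hl]
  · simp [hl, Ne.symm hl, Equiv.toPEquiv_apply]

/-- For a PQ-matrix the diagonal of `A ρ Aᴴ` depends only on the diagonal of `ρ`. -/
theorem IsPQ.diag_conj {A : Matrix n n ℂ} (hA : IsPQ A) (ρ : Matrix n n ℂ) :
    (A * ρ * Aᴴ).diag = (realPart A).map (fun r : ℝ => (r : ℂ)) *ᵥ ρ.diag := by
  obtain ⟨σ, d, rfl⟩ := hA
  ext k
  have h := permMatrix_mul_diagonal_apply σ d k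
  simp only [Matrix.diag_apply, Matrix.mul_apply, Matrix.conjTranspose_apply, h, Matrix.mulVec,
    dotProduct, Matrix.map_apply, realPart_apply]
  simp [apply_ite, ite_pow]
  rw [← Complex.mul_conj']
  ring

theorem step_lazyTransition_zero (A B : Matrix n n ℂ) (ρ : ℕ → Matrix n n ℂ) :
    step (lazyTransition A B) ρ 0 = A * ρ 1 * Aᴴ + B * ρ 0 * Bᴴ := by
  rw [step, tsum_eq_sum (s := {1, 0})]
  · simp [lazyTransition]
  · intro i hi
    simp only [Finset.mem_insert, Finset.mem_singleton, not_or] at hi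
    have : lazyTransition A B i 0 = 0 := by
      rw [lazyTransition, if_neg (by omega), if_neg (by omega)]
    simp [this]

theorem step_lazyTransition_succ (A B : Matrix n n ℂ) (ρ : ℕ → Matrix n n ℂ) (j : ℕ) :
    step (lazyTransition A B) ρ (j + 1) =
      A * ρ (j + 2) * Aᴴ + B * ρ (j + 1) * Bᴴ + A * ρ j * Aᴴ := by
  rw [step, tsum_eq_sum (s := {j + 2, j + 1, j})]
  · have h1 : lazyTransition A B (j + 2) (j + 1) = A := by
      rw [lazyTransition, if_neg (by omega), if_pos (by omega)]
    have h2 : lazyTransition A B j (j + 1) = A := by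
      rw [lazyTransition, if_neg (by omega), if_pos (by omega)]
    have h3 : lazyTransition A B (j + 1) (j + 1) = B := if_pos rfl
    rw [Finset.sum_insert (by simp), Finset.sum_insert (by simp), Finset.sum_singleton,
      h1, h2, h3, add_assoc]
  · intro i hi
    simp only [Finset.mem_insert, Finset.mem_singleton, not_or] at hi
    have : lazyTransition A B i (j + 1) = 0 := by
      rw [lazyTransition, if_neg (by omega), if_neg (by omega)]
    simp [this]

theorem map_ofReal_add_mulVec (M M' : Matrix n n ℝ) (v : n → ℂ) :
    (M + M').map (fun r : ℝ => (r : ℂ)) *ᵥ v =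
      M.map (fun r : ℝ => (r : ℂ)) *ᵥ v + M'.map (fun r : ℝ => (r : ℂ)) *ᵥ v := by
  rw [Matrix.map_add _ Complex.ofReal_add, Matrix.add_mulVec]

theorem map_ofReal_mul_mulVec (M M' : Matrix n n ℝ) (v : n → ℂ) :
    (M * M').map (fun r : ℝ => (r : ℂ)) *ᵥ v =
      M.map (fun r : ℝ => (r : ℂ)) *ᵥ (M'.map (fun r : ℝ => (r : ℂ)) *ᵥ v) := by
  rw [Matrix.mulVec_mulVec]
  congr 1
  exact Matrix.map_mul (f := Complex.ofRealHom)

/-- The diagonals of the site components evolve by the block Jacobi matrix of the real parts. -/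
theorem diag_step_iterate {A B : Matrix n n ℂ} (hA : IsPQ A) (hB : IsPQ B) (ρ : Matrix n n ℂ)
    (i j t : ℕ) :
    ((step (lazyTransition A B))^[t] (Pi.single i ρ) j).diag =
      (jacobiPow (realPart A) (realPart B) t j i).map (fun r : ℝ => (r : ℂ)) *ᵥ ρ.diag := by
  induction t generalizing j with
  | zero =>
    rcases eq_or_ne j i with rfl | h
    · simp [jacobiPow, Matrix.map_one]
    · simp [jacobiPow, h]
  | succ t ih =>
    rw [Function.iterate_succ_apply']
    rcases j with _ | j
    · rw [step_lazyTransition_zero, Matrix.diag_add, hA.diag_conj, hB.diag_conj, ih, ih, jacobiPow,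
        map_ofReal_add_mulVec, map_ofReal_mul_mulVec, map_ofReal_mul_mulVec]
    · rw [step_lazyTransition_succ, Matrix.diag_add, Matrix.diag_add, hA.diag_conj, hB.diag_conj,
        hA.diag_conj, ih, ih, ih, jacobiPow, map_ofReal_add_mulVec, map_ofReal_add_mulVec,
        map_ofReal_mul_mulVec, map_ofReal_mul_mulVec, map_ofReal_mul_mulVec]

theorem transitionProb_eq_sum_jacobiPow {A B : Matrix n n ℂ} (hA : IsPQ A) (hB : IsPQ B)
    (ρ : Matrix n n ℂ) (i j t : ℕ) :
    transitionProb (lazyTransition A B) ρ i j t =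
      ∑ k, ((jacobiPow (realPart A) (realPart B) t j i).map
        (fun r : ℝ => (r : ℂ)) *ᵥ ρ.diag) k := by
  rw [← diag_step_iterate hA hB]
  rfl

/-! ### Matrix measures assembled from scalar measures -/

/-- The matrix measure `∑ i, μ i • c i`, for finite measures `μ i` and matrices `c i`. The
coefficients need not be positive; only the sum is required to be. -/
def MatrixMeasure.ofMeasures {ι : Type*} [Fintype ι] (c : ι → Matrix n n ℝ)
    (μ : ι → FiniteMeasure ℝ)
    (h : ∀ s, MeasurableSet s → (∑ i, (μ i : Measure ℝ).real s • c i).PosSemidef) :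
    MatrixMeasure n where
  entry a b := ∑ i, c i a b • (μ i : Measure ℝ).toSignedMeasure
  posSemidef s hs := by
    convert h s hs
    ext a b
    simp [Matrix.sum_apply, Measure.toSignedMeasure_apply_measurable hs, mul_comm]

namespace MatrixMeasure

variable {ι : Type*} [Fintype ι] {c : ι → Matrix n n ℝ} {μ : ι → FiniteMeasure ℝ}
  {h : ∀ s, MeasurableSet s → (∑ i, (μ i : Measure ℝ).real s • c i).PosSemidef}

theorem ofMeasures_entry_apply {s : Set ℝ} (hs : MeasurableSet s) (a b : n) :
    (ofMeasures c μ h).entry a b s = ∑ i, (μ i : Measure ℝ).real s * c i a b := by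
  simp [ofMeasures, Measure.toSignedMeasure_apply_measurable hs, mul_comm]

theorem hasFiniteMoments_ofMeasures
    (hμ : ∀ i (k : ℕ), Integrable (fun x : ℝ => x ^ k) (μ i : Measure ℝ)) :
    (ofMeasures c μ h).HasFiniteMoments := by
  intro a b k
  refine VectorMeasure.Integrable.finsetSum_vectorMeasure fun i _ => ?_
  refine VectorMeasure.Integrable.smul_vectorMeasure ?_ _
  rw [VectorMeasure.Integrable, Measure.variation_toSignedMeasure]
  exact hμ i k

theorem integral_X_pow_ofMeasures
    (hμ : ∀ i (k : ℕ), Integrable (fun x : ℝ => x ^ k) (μ i : Measure ℝ)) (t : ℕ) :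
    (ofMeasures c μ h).integral (X ^ t) 1 1 = ∑ i, (∫ x, x ^ t ∂(μ i : Measure ℝ)) • c i := by
  have hi : ∀ i, (μ i : Measure ℝ).toSignedMeasure.Integrable fun x : ℝ => x ^ t := fun i => by
    rw [VectorMeasure.Integrable, Measure.variation_toSignedMeasure]
    exact hμ i t
  have hs : ∀ i, ∫ᵛ x, x ^ t ∂•(μ i : Measure ℝ).toSignedMeasure
      = ∫ x, x ^ t ∂(μ i : Measure ℝ) := fun i => by
    rw [← VectorMeasure.integral_toSignedMeasure]
    congr 1
    ext
    simp
  ext a b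
  rw [integral_apply, Finset.sum_eq_single a, Finset.sum_eq_single b]
  · simp only [Matrix.one_apply_eq, mul_one, moment, eval_pow, eval_X]
    simp only [ofMeasures]
    rw [VectorMeasure.integral_finsetSum_vectorMeasure
      fun i _ => VectorMeasure.Integrable.smul_vectorMeasure (hi i) _]
    simp only [VectorMeasure.integral_smul_vectorMeasure, hs, Matrix.sum_apply, Matrix.smul_apply,
      smul_eq_mul, mul_comm]
  · intro l _ hl
    simp [moment, Matrix.one_apply_ne hl.symm]
  · simp
  · intro k _ hk
    simp [moment, Matrix.one_apply_ne hk.symm]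
  · simp

end MatrixMeasure

/-- A linear relation between the integrals of all bounded continuous functions is a relation
between the measures. -/
theorem sum_mul_measure_real_eq_zero {ι : Type*} [Fintype ι] (c : ι → ℝ) (μ : ι → FiniteMeasure ℝ)
    (h : ∀ f : BoundedContinuousFunction ℝ ℝ, ∑ i, c i * ∫ x, f x ∂(μ i : Measure ℝ) = 0)
    (s : Set ℝ) : ∑ i, c i * (μ i : Measure ℝ).real s = 0 := by
  -- The positive and the negative coefficients give two positive measures, which agree.
  have key : (∑ i, (c i).toNNReal • (μ i : Measure ℝ)) =
      ∑ i, (-c i).toNNReal • (μ i : Measure ℝ) := by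
    refine ext_of_forall_integral_eq_of_IsFiniteMeasure fun f => ?_
    have hf : ∀ i, Integrable f (μ i : Measure ℝ) := fun i => f.integrable _
    rw [integral_finsetSum_measure fun i _ => (hf i).smul_measure_nnreal,
      integral_finsetSum_measure fun i _ => (hf i).smul_measure_nnreal, ← sub_eq_zero,
      ← Finset.sum_sub_distrib, ← h f]
    refine Finset.sum_congr rfl fun i _ => ?_
    rw [integral_smul_nnreal_measure, integral_smul_nnreal_measure, NNReal.smul_def,
      NNReal.smul_def, ← sub_smul, Real.coe_toNNReal', Real.coe_toNNReal',
      max_zero_sub_max_neg_zero_eq_self, smul_eq_mul]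
  have hr : ∀ d : ι → NNReal, (∑ i, d i • (μ i : Measure ℝ)).real s =
      ∑ i, (d i : ℝ) * (μ i : Measure ℝ).real s := fun d => by
    simp only [Measure.real, Measure.coe_finsetSum, Finset.sum_apply]
    rw [ENNReal.toReal_sum fun i _ => by
      rw [Measure.smul_apply]
      exact ENNReal.mul_ne_top ENNReal.coe_ne_top (measure_ne_top _ _)]
    refine Finset.sum_congr rfl fun i _ => ?_
    rw [Measure.smul_apply, ENNReal.smul_def, smul_eq_mul, ENNReal.toReal_mul, ENNReal.coe_toReal]
  have := congrArg (fun ν : Measure ℝ => ν.real s) key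
  simp only [hr] at this
  rw [← sub_eq_zero, ← Finset.sum_sub_distrib] at this
  rw [← this]
  refine Finset.sum_congr rfl fun i _ => ?_
  rw [← sub_mul, Real.coe_toNNReal', Real.coe_toNNReal', max_zero_sub_max_neg_zero_eq_self]

/-! ### Spectral measures of finite symmetric matrices -/

section Spectral

variable {m : Type*} [Fintype m] [DecidableEq m] {J : Matrix m m ℝ}

/-- The functional calculus in terms of an orthonormal basis of eigenvectors. -/
theorem cfc_apply_eq_sum (hJ : J.IsHermitian) (f : ℝ → ℝ) (p q : m) :
    cfc f J p q =
      ∑ l, f (hJ.eigenvalues l) * (hJ.eigenvectorBasis l p * hJ.eigenvectorBasis l q) := by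
  rw [hJ.cfc_eq, Matrix.IsHermitian.cfc, Unitary.conjStarAlgAut_apply, Matrix.mul_apply]
  refine Finset.sum_congr rfl fun l _ => ?_
  simp [Matrix.mul_diagonal, Matrix.star_apply, Matrix.IsHermitian.eigenvectorUnitary_apply]
  ring

/-- The spectral measure of the symmetric matrix `J` at the vector `u`. -/
def spectralMeasure (hJ : J.IsHermitian) (u : m → ℝ) : FiniteMeasure ℝ :=
  ∑ l, ((u ⬝ᵥ hJ.eigenvectorBasis l) ^ 2).toNNReal • (diracProba (hJ.eigenvalues l)).toFiniteMeasure

theorem toMeasure_spectralMeasure (hJ : J.IsHermitian) (u : m → ℝ) :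
    (spectralMeasure hJ u : Measure ℝ) =
      ∑ l, ((u ⬝ᵥ hJ.eigenvectorBasis l) ^ 2).toNNReal • Measure.dirac (hJ.eigenvalues l) := by
  rw [spectralMeasure, FiniteMeasure.toMeasure_sum]
  rfl

theorem integral_spectralMeasure (hJ : J.IsHermitian) (u : m → ℝ) (f : ℝ → ℝ) :
    ∫ x, f x ∂(spectralMeasure hJ u : Measure ℝ) =
      ∑ l, (u ⬝ᵥ hJ.eigenvectorBasis l) ^ 2 * f (hJ.eigenvalues l) := by
  rw [toMeasure_spectralMeasure, integral_finsetSum_measure]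
  · refine Finset.sum_congr rfl fun l _ => ?_
    rw [integral_smul_nnreal_measure, NNReal.smul_def,
      Real.coe_toNNReal _ (sq_nonneg _), integral_dirac, smul_eq_mul]
  · intro l _
    exact Integrable.smul_measure_nnreal (integrable_dirac (by simp))

theorem integral_pow_spectralMeasure (hJ : J.IsHermitian) (u : m → ℝ) (t : ℕ) :
    ∫ x, x ^ t ∂(spectralMeasure hJ u : Measure ℝ) = u ⬝ᵥ (J ^ t *ᵥ u) := by
  have h : ∀ p q, (J ^ t) p q = ∑ l, hJ.eigenvalues l ^ t *
      (hJ.eigenvectorBasis l p * hJ.eigenvectorBasis l q) := fun p q => by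
    rw [← cfc_apply_eq_sum hJ (fun x => x ^ t), cfc_pow_id (R := ℝ) J t hJ.isSelfAdjoint]
  rw [integral_spectralMeasure]
  simp only [Matrix.mulVec, dotProduct, h, sq, Finset.sum_mul, Finset.mul_sum]
  rw [Finset.sum_comm]
  refine Finset.sum_congr rfl fun p _ => ?_
  rw [Finset.sum_comm]
  conv_rhs => rw [Finset.sum_comm]
  rw [Finset.sum_comm]
  refine Finset.sum_congr rfl fun q _ => Finset.sum_congr rfl fun l _ => ?_
  ring

theorem spectralMeasure_apply_eq_zero (hJ : J.IsHermitian) (u : m → ℝ) {s : Set ℝ}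
    (hs : MeasurableSet s) (h : ∀ l, hJ.eigenvalues l ∉ s) : spectralMeasure hJ u s = 0 := by
  rw [FiniteMeasure.null_iff_toMeasure_null, toMeasure_spectralMeasure,
    Measure.coe_finsetSum, Finset.sum_apply]
  refine Finset.sum_eq_zero fun l _ => ?_
  rw [Measure.smul_apply, Measure.dirac_apply' _ hs, Set.indicator_of_notMem (h l), smul_zero]

theorem spectralMeasure_mass (hJ : J.IsHermitian) (u : m → ℝ) :
    ((spectralMeasure hJ u).mass : ℝ) = u ⬝ᵥ u := by
  have := integral_pow_spectralMeasure hJ u 0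
  simp only [pow_zero, integral_const, Matrix.one_mulVec, smul_eq_mul, mul_one] at this
  exact this

/-- Every eigenvalue is bounded by a bound for the absolute row sums. -/
theorem abs_eigenvalues_le (hJ : J.IsHermitian) {R : ℝ} (hR : ∀ p, ∑ q, |J p q| ≤ R) (l : m) :
    |hJ.eigenvalues l| ≤ R := by
  have he : Module.End.HasEigenvalue (toLin' J) (hJ.eigenvalues l) := by
    refine Module.End.hasEigenvalue_of_hasEigenvector (x := (hJ.eigenvectorBasis l).ofLp) ⟨?_, ?_⟩
    · rw [Module.End.mem_eigenspace_iff, toLin'_apply]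
      exact hJ.mulVec_eigenvectorBasis l
    · intro h0
      exact hJ.eigenvectorBasis.orthonormal.ne_zero l (by ext p; exact congrFun h0 p)
  obtain ⟨k, hk⟩ := eigenvalue_mem_ball he
  rw [Metric.mem_closedBall, Real.dist_eq] at hk
  have hsum := hR k
  rw [← Finset.add_sum_erase _ _ (Finset.mem_univ k)] at hsum
  simp only [Real.norm_eq_abs] at hk
  have := abs_sub_abs_le_abs_sub (hJ.eigenvalues l) (J k k)
  linarith

end Spectral

/-! ### Truncated block Jacobi matrices -/

/-- The block at position `(j, k)` of the block tridiagonal matrix. -/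
def jacobiBlock (A B : Matrix n n ℝ) (j k : ℕ) : Matrix n n ℝ :=
  if j = k then B else if j + 1 = k ∨ k + 1 = j then A else 0

/-- The block tridiagonal matrix restricted to the first `M` sites. -/
def truncJacobi (A B : Matrix n n ℝ) (M : ℕ) : Matrix (Fin M × n) (Fin M × n) ℝ :=
  Matrix.of fun p q => jacobiBlock A B p.1 q.1 p.2 q.2

theorem truncJacobi_isHermitian {A B : Matrix n n ℝ} (hA : A.IsSymm) (hB : B.IsSymm) (M : ℕ) :
    (truncJacobi A B M).IsHermitian := by
  ext p q
  simp only [Matrix.conjTranspose_apply, truncJacobi, Matrix.of_apply, star_trivial, jacobiBlock]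
  split_ifs <;> first | omega | exact hB.apply _ _ | exact hA.apply _ _ | rfl

theorem jacobiBlock_self (A B : Matrix n n ℝ) (j : ℕ) : jacobiBlock A B j j = B := if_pos rfl

theorem jacobiBlock_succ_right (A B : Matrix n n ℝ) (j : ℕ) : jacobiBlock A B j (j + 1) = A := by
  rw [jacobiBlock, if_neg (by omega), if_pos (by omega)]

theorem jacobiBlock_succ_left (A B : Matrix n n ℝ) (j : ℕ) : jacobiBlock A B (j + 1) j = A := by
  rw [jacobiBlock, if_neg (by omega), if_pos (by omega)]

theorem jacobiBlock_eq_zero (A B : Matrix n n ℝ) {j k : ℕ} (h : j ≠ k) (h1 : j + 1 ≠ k)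
    (h2 : k + 1 ≠ j) : jacobiBlock A B j k = 0 := by
  rw [jacobiBlock, if_neg h, if_neg (by omega)]

theorem sum_jacobiBlock_mul (A B : Matrix n n ℝ) {M t j : ℕ} (i : ℕ) (h : j + 1 < M) :
    ∑ k ∈ Finset.range M, jacobiBlock A B j k * jacobiPow A B t k i =
      jacobiPow A B (t + 1) j i := by
  rcases j with _ | j
  · rw [← Finset.sum_subset (s₁ := {1, 0})]
    · rw [Finset.sum_insert (by simp), Finset.sum_singleton, jacobiBlock_succ_right,
        jacobiBlock_self, jacobiPow]
    · intro k hk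
      simp only [Finset.mem_insert, Finset.mem_singleton] at hk
      simp only [Finset.mem_range]
      omega
    · intro k _ hk
      simp only [Finset.mem_insert, Finset.mem_singleton] at hk
      rw [jacobiBlock_eq_zero A B (by omega) (by omega) (by omega), zero_mul]
  · rw [← Finset.sum_subset (s₁ := {j + 2, j + 1, j})]
    · rw [Finset.sum_insert (by simp), Finset.sum_insert (by simp), Finset.sum_singleton,
        jacobiBlock_succ_right, jacobiBlock_self, jacobiBlock_succ_left, jacobiPow, add_assoc]
    · intro k hk
      simp only [Finset.mem_insert, Finset.mem_singleton] at hk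
      simp only [Finset.mem_range]
      omega
    · intro k _ hk
      simp only [Finset.mem_insert, Finset.mem_singleton] at hk
      rw [jacobiBlock_eq_zero A B (by omega) (by omega) (by omega), zero_mul]

/-- The truncation to `M` sites is not felt by the `t`-th power at sites `j` with `j + t < M`. -/
theorem truncJacobi_pow_apply (A B : Matrix n n ℝ) (M t : ℕ) (p q : Fin M × n)
    (h : (p.1 : ℕ) + t < M) :
    (truncJacobi A B M ^ t) p q = jacobiPow A B t p.1 q.1 p.2 q.2 := by
  induction t generalizing p with
  | zero =>
    obtain ⟨j, a⟩ := p
    obtain ⟨i, b⟩ := q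
    rw [pow_zero, jacobiPow]
    by_cases hji : j = i
    · subst hji
      simp [Matrix.one_apply]
    · have : (j : ℕ) ≠ i := fun h => hji (Fin.ext h)
      simp [hji, this]
  | succ t ih =>
    have hterm : ∀ k : Fin M, ∑ c, truncJacobi A B M p (k, c) * (truncJacobi A B M ^ t) (k, c) q =
        (jacobiBlock A B p.1 k * jacobiPow A B t k q.1) p.2 q.2 := fun k => by
      rw [Matrix.mul_apply]
      refine Finset.sum_congr rfl fun c _ => ?_
      by_cases hk : (k : ℕ) + t < M
      · rw [ih (k, c) hk]
        rfl
      · have : jacobiBlock A B p.1 k = 0 :=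
          jacobiBlock_eq_zero A B (by omega) (by omega) (by omega)
        simp [truncJacobi, this]
    rw [pow_succ', Matrix.mul_apply, Fintype.sum_prod_type, Finset.sum_congr rfl fun k _ => hterm k,
      ← sum_jacobiBlock_mul A B (M := M) _ (by omega), Matrix.sum_apply,
      ← Fin.sum_univ_eq_sum_range
        (fun k => (jacobiBlock A B p.1 k * jacobiPow A B t k q.1) p.2 q.2)]

/-- A bound for the absolute row sums, hence for the spectral radii, of all the truncations. -/
def jacobiBound (A B : Matrix n n ℝ) : ℝ :=
  ∑ a, ∑ b, (|B a b| + 2 * |A a b|)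

theorem sum_abs_truncJacobi_le (A B : Matrix n n ℝ) (M : ℕ) (p : Fin M × n) :
    ∑ q, |truncJacobi A B M p q| ≤ jacobiBound A B := by
  have hsingle : ∀ (P : Fin M → Prop) [DecidablePred P] (x : ℝ), 0 ≤ x →
      (∀ k l, P k → P l → k = l) → ∑ k, (if P k then x else 0) ≤ x := fun P _ x hx hP => by
    rw [← Finset.sum_filter, Finset.sum_const, nsmul_eq_mul]
    have : (Finset.univ.filter P).card ≤ 1 := Finset.card_le_one.2 fun k hk l hl =>
      hP k l (Finset.mem_filter.1 hk).2 (Finset.mem_filter.1 hl).2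
    have : ((Finset.univ.filter P).card : ℝ) ≤ 1 := by exact_mod_cast this
    nlinarith
  have hrow : ∀ b, ∑ k : Fin M, |truncJacobi A B M p (k, b)| ≤ |B p.2 b| + 2 * |A p.2 b| := by
    intro b
    calc ∑ k : Fin M, |truncJacobi A B M p (k, b)|
        ≤ ∑ k : Fin M, ((if (p.1 : ℕ) = k then |B p.2 b| else 0) +
            (if (p.1 : ℕ) + 1 = k then |A p.2 b| else 0) +
            (if (k : ℕ) + 1 = p.1 then |A p.2 b| else 0)) := by
          refine Finset.sum_le_sum fun k _ => ?_
          have h1 := abs_nonneg (A p.2 b)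
          have h2 := abs_nonneg (B p.2 b)
          simp only [truncJacobi, Matrix.of_apply, jacobiBlock]
          split_ifs <;> first | omega | simp_all
      _ ≤ |B p.2 b| + |A p.2 b| + |A p.2 b| := by
          rw [Finset.sum_add_distrib, Finset.sum_add_distrib]
          gcongr
          · exact hsingle (fun k : Fin M => (p.1 : ℕ) = k) _ (abs_nonneg _)
              fun k l hk hl => by omega
          · exact hsingle (fun k : Fin M => (p.1 : ℕ) + 1 = k) _ (abs_nonneg _)
              fun k l hk hl => by omega
          · exact hsingle (fun k : Fin M => (k : ℕ) + 1 = p.1) _ (abs_nonneg _)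
              fun k l hk hl => by omega
      _ = |B p.2 b| + 2 * |A p.2 b| := by ring
  rw [Fintype.sum_prod_type, Finset.sum_comm]
  refine (Finset.sum_le_sum fun b _ => hrow b).trans ?_
  exact Finset.single_le_sum (f := fun a => ∑ b, (|B a b| + 2 * |A a b|))
    (fun a _ => Finset.sum_nonneg fun b _ => by positivity) (Finset.mem_univ p.2)

/-! ### Existence of an orthogonality measure -/

/-- The vector with value `v` at site `0` and `0` at the other sites. -/
def atZero (M : ℕ) (v : n → ℝ) : Fin (M + 1) × n → ℝ :=
  fun p => if p.1 = 0 then v p.2 else 0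

theorem atZero_dotProduct (M : ℕ) (v : n → ℝ) (w : Fin (M + 1) × n → ℝ) :
    atZero M v ⬝ᵥ w = v ⬝ᵥ fun a => w (0, a) := by
  simp only [dotProduct, atZero, Fintype.sum_prod_type, ite_mul, zero_mul]
  rw [Finset.sum_comm]
  simp

/-- The spectral measure of the truncation at a vector supported at site `0`. -/
def truncMeasure {A B : Matrix n n ℝ} (hA : A.IsSymm) (hB : B.IsSymm) (v : n → ℝ) (M : ℕ) :
    FiniteMeasure ℝ :=
  spectralMeasure (truncJacobi_isHermitian hA hB (M + 1)) (atZero M v)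

section

variable {A B : Matrix n n ℝ} (hA : A.IsSymm) (hB : B.IsSymm)

theorem truncMeasure_neg (v : n → ℝ) (M : ℕ) :
    truncMeasure hA hB (-v) M = truncMeasure hA hB v M := by
  simp only [truncMeasure, spectralMeasure, atZero_dotProduct, neg_dotProduct, neg_sq]

theorem integral_pow_truncMeasure (v : n → ℝ) {M t : ℕ} (h : t ≤ M) :
    ∫ x, x ^ t ∂(truncMeasure hA hB v M : Measure ℝ) = v ⬝ᵥ (jacobiPow A B t 0 0 *ᵥ v) := by
  rw [truncMeasure, integral_pow_spectralMeasure, atZero_dotProduct]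
  congr 1
  ext a
  rw [Matrix.mulVec, dotProduct_comm, atZero_dotProduct, dotProduct_comm, Matrix.mulVec]
  congr 1
  ext b
  rw [truncJacobi_pow_apply _ _ _ _ _ _ (by simpa using Nat.lt_succ_of_le h)]
  rfl

/-- Polarization of the truncated spectral measures, which are quadratic in the vector. -/
theorem integral_truncMeasure_polarization (v : n → ℝ) (M : ℕ) (f : ℝ → ℝ) :
    ∫ x, f x ∂(truncMeasure hA hB v M : Measure ℝ) =
      ∑ a, ∑ b, v a * v b / 4 *
        (∫ x, f x ∂(truncMeasure hA hB (Pi.single a 1 + Pi.single b 1) M : Measure ℝ) -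
          ∫ x, f x ∂(truncMeasure hA hB (Pi.single a 1 - Pi.single b 1) M : Measure ℝ)) := by
  simp only [truncMeasure, integral_spectralMeasure, atZero_dotProduct, add_dotProduct,
    sub_dotProduct, single_one_dotProduct]
  simp only [← Finset.sum_sub_distrib, Finset.mul_sum]
  conv_rhs => enter [2, a]; rw [Finset.sum_comm]
  rw [Finset.sum_comm]
  refine Finset.sum_congr rfl fun l _ => ?_
  rw [dotProduct, sq, Finset.sum_mul_sum, Finset.sum_mul]
  refine Finset.sum_congr rfl fun a _ => ?_
  rw [Finset.sum_mul]
  refine Finset.sum_congr rfl fun b _ => ?_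
  ring

theorem truncMeasure_compl_Icc (v : n → ℝ) (M : ℕ) :
    truncMeasure hA hB v M (Set.Icc (-jacobiBound A B) (jacobiBound A B))ᶜ = 0 :=
  spectralMeasure_apply_eq_zero _ _ measurableSet_Icc.compl fun l hl =>
    hl (abs_le.1 (abs_eigenvalues_le _ (sum_abs_truncJacobi_le A B (M + 1)) l))

/-- The truncated spectral measures converge along an ultrafilter, as their masses are bounded and
they are carried by a common compact interval. -/
theorem exists_limit_truncMeasure (v : n → ℝ) :
    ∃ μ : FiniteMeasure ℝ, μ (Set.Icc (-jacobiBound A B) (jacobiBound A B))ᶜ = 0 ∧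
      Filter.Tendsto (truncMeasure hA hB v) (Filter.hyperfilter ℕ) (nhds μ) := by
  obtain ⟨μ, hμ, hlim⟩ := (isCompact_setOfPred_finiteMeasure_le_of_isCompact
    (v ⬝ᵥ v).toNNReal (isCompact_Icc (a := -jacobiBound A B) (b := jacobiBound A B))
    ).ultrafilter_le_nhds ((Filter.hyperfilter ℕ).map (truncMeasure hA hB v)) (by
      rw [Ultrafilter.coe_map, Filter.le_principal_iff, Filter.mem_map]
      refine Filter.univ_mem' fun M => ⟨?_, truncMeasure_compl_Icc hA hB v M⟩
      rw [← NNReal.coe_le_coe, truncMeasure, spectralMeasure_mass, atZero_dotProduct]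
      exact (le_of_eq (by simp [atZero])).trans (Real.le_coe_toNNReal _))
  exact ⟨μ, hμ.2, hlim⟩

end

theorem ae_mem_Icc {μ : FiniteMeasure ℝ} {R : ℝ} (h : μ (Set.Icc (-R) R)ᶜ = 0) :
    ∀ᵐ x ∂(μ : Measure ℝ), x ∈ Set.Icc (-R) R :=
  (FiniteMeasure.null_iff_toMeasure_null _ _).1 h

theorem integrable_pow_of_bounded {μ : FiniteMeasure ℝ} {R : ℝ} (h : μ (Set.Icc (-R) R)ᶜ = 0)
    (k : ℕ) : Integrable (fun x : ℝ => x ^ k) (μ : Measure ℝ) := by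
  refine Integrable.of_bound (by fun_prop) (R ^ k) ?_
  filter_upwards [ae_mem_Icc h] with x hx
  rw [norm_pow]
  exact pow_le_pow_left₀ (norm_nonneg _) (abs_le.2 hx) k

/-- Weak convergence of measures on a common bounded interval implies convergence of moments. -/
theorem tendsto_integral_pow {γ : Type*} {F : Filter γ} {μs : γ → FiniteMeasure ℝ}
    {μ : FiniteMeasure ℝ} {R : ℝ} (hs : ∀ i, μs i (Set.Icc (-R) R)ᶜ = 0)
    (h : μ (Set.Icc (-R) R)ᶜ = 0) (hlim : Filter.Tendsto μs F (nhds μ)) (t : ℕ) :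
    Filter.Tendsto (fun i => ∫ x, x ^ t ∂(μs i : Measure ℝ)) F
      (nhds (∫ x, x ^ t ∂(μ : Measure ℝ))) := by
  -- The power `x ^ t`, made bounded by clamping `x` to the interval.
  let f : BoundedContinuousFunction ℝ ℝ :=
    BoundedContinuousFunction.ofNormedAddCommGroup (fun x => (max (-R) (min x R)) ^ t)
      (by fun_prop) (|R| ^ t) (fun x => by
        rw [norm_pow]
        refine pow_le_pow_left₀ (norm_nonneg _) (abs_le.2 ⟨?_, ?_⟩) t
        · exact (neg_le_neg (le_abs_self R)).trans (le_max_left _ _)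
        · exact max_le (neg_le_abs R) ((min_le_right _ _).trans (le_abs_self R)))
  have key : ∀ ν : FiniteMeasure ℝ, ν (Set.Icc (-R) R)ᶜ = 0 →
      ∫ x, f x ∂(ν : Measure ℝ) = ∫ x, x ^ t ∂(ν : Measure ℝ) := fun ν hν => by
    refine integral_congr_ae ?_
    filter_upwards [ae_mem_Icc hν] with x hx
    change (max (-R) (min x R)) ^ t = x ^ t
    rw [min_eq_left hx.2, max_eq_right hx.1]
  have := (FiniteMeasure.tendsto_iff_forall_integral_tendsto.1 hlim) f
  rw [key μ h] at this
  exact this.congr fun i => key _ (hs i)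

/-- A symmetric matrix is recovered from its quadratic form by polarization. -/
theorem eq_of_polarization {S T : Matrix n n ℝ} (hS : S.IsSymm)
    (h : ∀ a b, T a b = ((Pi.single a 1 + Pi.single b 1) ⬝ᵥ (S *ᵥ (Pi.single a 1 + Pi.single b 1)) -
      (Pi.single a 1 - Pi.single b 1) ⬝ᵥ (S *ᵥ (Pi.single a 1 - Pi.single b 1))) / 4) : T = S := by
  ext a b
  rw [h]
  simp only [Matrix.mulVec_add, Matrix.mulVec_sub, add_dotProduct, sub_dotProduct, dotProduct_add,
    dotProduct_sub, single_one_dotProduct, Matrix.mulVec_single_one, Matrix.col_apply,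
    hS.apply a b]
  ring

theorem jacobiPow_zero_zero_isSymm {A B : Matrix n n ℝ} (hA : A.IsSymm) (hB : B.IsSymm) (t : ℕ) :
    (jacobiPow A B t 0 0).IsSymm := by
  have h := (truncJacobi_isHermitian hA hB (t + 1)).pow t
  ext a b
  have := h.apply (0, a) (0, b)
  rw [truncJacobi_pow_apply _ _ _ _ _ _ (by simp), truncJacobi_pow_apply _ _ _ _ _ _ (by simp)]
    at this
  exact this

/-- For symmetric `A` and `B` the blocks `(0, 0)` of the powers of the block Jacobi matrix are the
moments of a matrix measure. Its quadratic forms are limits, along an ultrafilter, of spectral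
measures of truncations; these live on a common compact interval, and their `t`-th moments are
eventually constant. -/
theorem exists_matrixMeasure_of_isSymm {A B : Matrix n n ℝ} (hA : A.IsSymm) (hB : B.IsSymm) :
    ∃ W : MatrixMeasure n, W.HasFiniteMoments ∧
      ∀ t, W.integral (X ^ t) 1 1 = jacobiPow A B t 0 0 := by
  choose μ hsupp hlim using exists_limit_truncMeasure hA hB
  have hneg : ∀ v, μ (-v) = μ v := fun v => by
    refine tendsto_nhds_unique (hlim (-v)) ?_
    rw [show truncMeasure hA hB (-v) = truncMeasure hA hB v from
      funext (truncMeasure_neg hA hB v)]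
    exact hlim v
  have hmom : ∀ v t, ∫ x, x ^ t ∂(μ v : Measure ℝ) = v ⬝ᵥ (jacobiPow A B t 0 0 *ᵥ v) := by
    intro v t
    refine tendsto_nhds_unique (tendsto_integral_pow (truncMeasure_compl_Icc hA hB v)
      (hsupp v) (hlim v) t) (tendsto_const_nhds.congr' ?_)
    have : ∀ᶠ M in (Filter.hyperfilter ℕ : Filter ℕ), t ≤ M :=
      (Filter.hyperfilter_le_cofinite.trans Nat.cofinite_eq_atTop.le) (Filter.eventually_ge_atTop t)
    filter_upwards [this] with M hM
    exact (integral_pow_truncMeasure hA hB v hM).symm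
  have hpol : ∀ (v : n → ℝ) (f : BoundedContinuousFunction ℝ ℝ), ∫ x, f x ∂(μ v : Measure ℝ) =
      ∑ a, ∑ b, v a * v b / 4 * (∫ x, f x ∂(μ (Pi.single a 1 + Pi.single b 1) : Measure ℝ) -
        ∫ x, f x ∂(μ (Pi.single a 1 - Pi.single b 1) : Measure ℝ)) := fun v f => by
    have hf := fun w => FiniteMeasure.tendsto_iff_forall_integral_tendsto.1 (hlim w) f
    refine tendsto_nhds_unique (hf v) ?_
    simp only [integral_truncMeasure_polarization hA hB v]
    exact tendsto_finsetSum _ fun a _ => tendsto_finsetSum _ fun b _ =>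
      ((hf _).sub (hf _)).const_mul _
  -- The entry `(a, b)` of `W` is `(μ (e_a + e_b) - μ (e_a - e_b)) / 4`.
  let c : (n × n) ⊕ (n × n) → Matrix n n ℝ :=
    Sum.elim (fun p => Matrix.single p.1 p.2 (1 / 4)) (fun p => Matrix.single p.1 p.2 (-1 / 4))
  let ν : (n × n) ⊕ (n × n) → FiniteMeasure ℝ :=
    Sum.elim (fun p => μ (Pi.single p.1 1 + Pi.single p.2 1))
      (fun p => μ (Pi.single p.1 1 - Pi.single p.2 1))
  have hsum : ∀ (r : (n × n) ⊕ (n × n) → ℝ) (a b : n), (∑ i, r i • c i) a b =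
      (r (.inl (a, b)) - r (.inr (a, b))) / 4 := fun r a b => by
    have h1 : ∀ (s : n × n → ℝ) (x : ℝ), ∑ p : n × n, (s p • Matrix.single p.1 p.2 x) a b =
        s (a, b) * x := fun s x => by
      rw [Finset.sum_eq_single (a, b)]
      · simp
      · rintro ⟨a', b'⟩ _ h
        rw [Matrix.smul_apply, Matrix.single_apply_of_ne, smul_zero]
        rintro ⟨rfl, rfl⟩
        exact h rfl
      · simp
    rw [Matrix.sum_apply, Fintype.sum_sum_type]
    simp only [c, Sum.elim_inl, Sum.elim_inr]
    rw [h1 (fun p => r (.inl p)), h1 (fun p => r (.inr p))]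
    ring
  refine ⟨MatrixMeasure.ofMeasures c ν fun s hs => ?_,
    MatrixMeasure.hasFiniteMoments_ofMeasures fun i k => ?_, fun t => ?_⟩
  · refine Matrix.PosSemidef.of_dotProduct_mulVec_nonneg ?_ fun v => ?_
    · ext a b
      rw [Matrix.conjTranspose_apply, star_trivial, hsum, hsum]
      simp only [ν, Sum.elim_inl, Sum.elim_inr]
      rw [add_comm, ← neg_sub (Pi.single a 1 : n → ℝ), hneg]
    -- The quadratic form of the matrix at `v` is the value of the positive measure `μ v`.
    · have h0 := sum_mul_measure_real_eq_zero
        (ι := Unit ⊕ ((n × n) ⊕ (n × n)))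
        (Sum.elim (fun _ => -1) (Sum.elim (fun p => v p.1 * v p.2 / 4)
          (fun p => -(v p.1 * v p.2 / 4))))
        (Sum.elim (fun _ => μ v) ν) (fun f => by
          have := hpol v f
          simp only [Fintype.sum_sum_type, Sum.elim_inl, Sum.elim_inr, ν, Finset.univ_unique,
            Finset.sum_singleton, Fintype.sum_prod_type, neg_mul, one_mul, Finset.sum_neg_distrib]
          rw [this]
          simp only [mul_sub, Finset.sum_sub_distrib]
          ring) s
      simp only [Fintype.sum_sum_type, Sum.elim_inl, Sum.elim_inr, Finset.univ_unique,
        Finset.sum_singleton, Fintype.sum_prod_type, neg_mul, one_mul, Finset.sum_neg_distrib] at h0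
      have h2 : star v ⬝ᵥ (∑ i, (ν i : Measure ℝ).real s • c i) *ᵥ v =
          (μ v : Measure ℝ).real s := by
        simp only [dotProduct, Matrix.mulVec, hsum (fun i => (ν i : Measure ℝ).real s),
          star_trivial, Finset.mul_sum]
        rw [← sub_eq_zero, ← h0, sub_eq_neg_add]
        congr 1
        rw [← sub_eq_add_neg, ← Finset.sum_sub_distrib]
        refine Finset.sum_congr rfl fun a _ => ?_
        rw [← Finset.sum_sub_distrib]
        refine Finset.sum_congr rfl fun b _ => ?_
        ring
      rw [h2]
      exact measureReal_nonneg
  · rcases i with p | p <;> exact integrable_pow_of_bounded (hsupp _) k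
  · rw [MatrixMeasure.integral_X_pow_ofMeasures]
    · refine eq_of_polarization (jacobiPow_zero_zero_isSymm hA hB t) fun a b => ?_
      rw [hsum]
      simp only [ν, Sum.elim_inl, Sum.elim_inr, hmom]
    · rintro (p | p) k <;> exact integrable_pow_of_bounded (hsupp _) k

/-! ### Semicircle laws -/

/-- The density of the semicircle law with centre `β` and radius `2 α`. -/
def semicircleDensity (α β x : ℝ) : ℝ :=
  (Real.pi * α)⁻¹ * Real.sqrt (max (1 - ((x - β) / (2 * α)) ^ 2) 0)

theorem continuous_semicircleDensity (α β : ℝ) : Continuous (semicircleDensity α β) := by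
  unfold semicircleDensity
  fun_prop

theorem semicircleDensity_nonneg {α : ℝ} (hα : 0 < α) (β x : ℝ) :
    0 ≤ semicircleDensity α β x := by
  unfold semicircleDensity
  positivity

theorem hasCompactSupport_semicircleDensity {α : ℝ} (hα : 0 < α) (β : ℝ) :
    HasCompactSupport (semicircleDensity α β) := by
  refine HasCompactSupport.intro (isCompact_Icc (a := β - 2 * α) (b := β + 2 * α)) fun x hx => ?_
  have h1 : 1 ≤ ((x - β) / (2 * α)) ^ 2 := by
    rw [one_le_sq_iff_one_le_abs, abs_div, abs_of_pos (by positivity : (0 : ℝ) < 2 * α),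
      one_le_div (by positivity), le_abs]
    by_contra! h
    exact hx ⟨by linarith, by linarith⟩
  rw [semicircleDensity, max_eq_right (by linarith), Real.sqrt_zero, mul_zero]

theorem integrable_mul_semicircleDensity {α : ℝ} (hα : 0 < α) (β : ℝ) {f : ℝ → ℝ}
    (hf : Continuous f) : Integrable fun x => f x * semicircleDensity α β x :=
  (hf.mul (continuous_semicircleDensity α β)).integrable_of_hasCompactSupport
    (hasCompactSupport_semicircleDensity hα β).mul_left

/-- Orthogonality of the Chebyshev polynomials of the second kind to the constants: multiplied by
`1 - x ^ 2`, `U_j` becomes `(T_j - T_{j + 2}) / 2`. -/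
theorem integral_chebyshev_U_mul_sqrt (j : ℕ) :
    ∫ x, (Chebyshev.U ℝ j).eval x * Real.sqrt (max (1 - x ^ 2) 0) =
      if j = 0 then Real.pi / 2 else 0 := by
  have h1 : ∫ x, (Chebyshev.U ℝ j).eval x * Real.sqrt (max (1 - x ^ 2) 0) =
      ∫ x, ((Chebyshev.T ℝ j).eval x - (Chebyshev.T ℝ (j + 2)).eval x) / 2 ∂Chebyshev.measureT := by
    rw [Chebyshev.integral_measureT, intervalIntegral.integral_of_le (by norm_num),
      ← integral_indicator measurableSet_Ioc]
    congr 1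
    funext x
    by_cases hx : x ∈ Set.Ioc (-1 : ℝ) 1
    · rw [Set.indicator_of_mem hx]
      have h0 : 0 ≤ 1 - x ^ 2 := by nlinarith [hx.1, hx.2]
      have hT : ((Chebyshev.T ℝ j).eval x - (Chebyshev.T ℝ (j + 2)).eval x) / 2 =
          (1 - x ^ 2) * (Chebyshev.U ℝ j).eval x := by
        have e1 := congrArg (Polynomial.eval x) (Chebyshev.one_sub_X_sq_mul_U_eq_pol_in_T ℝ j)
        have e2 := congrArg (Polynomial.eval x) (Chebyshev.T_add_two ℝ j)
        simp only [eval_mul, eval_sub, eval_one, eval_pow, eval_X, eval_ofNat] at e1 e2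
        rw [e1, e2]
        ring
      rw [hT, max_eq_left h0]
      rcases h0.eq_or_lt with h0 | h0
      · simp [← h0]
      · have hs := Real.sqrt_ne_zero'.2 h0
        rw [Real.sqrt_inv, ← div_eq_mul_inv, eq_div_iff hs, mul_assoc, Real.mul_self_sqrt h0.le]
        ring
    · rw [Set.indicator_of_notMem hx, max_eq_right, Real.sqrt_zero, mul_zero]
      by_contra! h
      exact hx ⟨by nlinarith, by nlinarith⟩
  have hi : ∀ k : ℤ, Integrable (fun x => (Chebyshev.T ℝ k).eval x) Chebyshev.measureT := fun k =>
    Chebyshev.integrable_measureT (Polynomial.continuous _).continuousOn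
  rw [h1, integral_div, integral_sub (hi _) (hi _),
    Chebyshev.integral_eval_T_real_measureT_of_ne_zero (n := j + 2) (by omega)]
  split_ifs with hj
  · subst hj
    rw [Nat.cast_zero, Chebyshev.integral_eval_T_real_measureT_zero, sub_zero]
  · rw [Chebyshev.integral_eval_T_real_measureT_of_ne_zero (by omega), sub_zero, zero_div]

/-- The mixed moments `∫ x ^ t U_j((x - β) / 2 α)` of the semicircle law; the functions
`U_j((x - β) / 2 α)` are its orthonormal polynomials. -/
def semicircleMoment (α β : ℝ) (t : ℕ) (j : ℤ) : ℝ :=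
  ∫ x, x ^ t * (Chebyshev.U ℝ j).eval ((x - β) / (2 * α)) * semicircleDensity α β x

theorem semicircleMoment_zero {α : ℝ} (hα : 0 < α) (β : ℝ) (j : ℕ) :
    semicircleMoment α β 0 j = if j = 0 then 1 else 0 := by
  have h := integral_chebyshev_U_mul_sqrt j
  simp only [semicircleMoment, semicircleDensity, pow_zero, one_mul]
  rw [integral_sub_right_eq_self (fun x => (Chebyshev.U ℝ j).eval (x / (2 * α)) *
      ((Real.pi * α)⁻¹ * Real.sqrt (max (1 - (x / (2 * α)) ^ 2) 0))) β,
    Measure.integral_comp_div (fun x => (Chebyshev.U ℝ j).eval x *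
      ((Real.pi * α)⁻¹ * Real.sqrt (max (1 - x ^ 2) 0))) (2 * α)]
  simp only [mul_left_comm _ (Real.pi * α)⁻¹]
  rw [integral_const_mul, h, abs_of_pos (by positivity)]
  have := Real.pi_ne_zero
  split_ifs
  · simp only [smul_eq_mul]
    field_simp
  · simp

theorem semicircleMoment_neg_one (α β : ℝ) (t : ℕ) : semicircleMoment α β t (-1) = 0 := by
  simp [semicircleMoment]

theorem semicircleMoment_succ {α : ℝ} (hα : 0 < α) (β : ℝ) (t : ℕ) (j : ℤ) :
    semicircleMoment α β (t + 1) j = α * semicircleMoment α β t (j + 1) +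
      β * semicircleMoment α β t j + α * semicircleMoment α β t (j - 1) := by
  have hi : ∀ (c : ℝ) (k : ℤ), Integrable fun x => c * (x ^ t *
      (Chebyshev.U ℝ k).eval ((x - β) / (2 * α)) * semicircleDensity α β x) := fun c k =>
    (integrable_mul_semicircleDensity hα β ((continuous_id.pow t).mul
      ((Polynomial.continuous _).comp (by fun_prop)))).const_mul c
  have h2 : Integrable fun x =>
      α * (x ^ t * (Chebyshev.U ℝ (j + 1)).eval ((x - β) / (2 * α)) * semicircleDensity α β x) +
        β * (x ^ t * (Chebyshev.U ℝ j).eval ((x - β) / (2 * α)) * semicircleDensity α β x) :=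
    (hi α (j + 1)).add (hi β j)
  simp only [semicircleMoment]
  rw [← integral_const_mul, ← integral_const_mul, ← integral_const_mul,
    ← integral_add (hi _ _) (hi _ _), ← integral_add h2 (hi _ _)]
  refine integral_congr_ae (Filter.Eventually.of_forall fun x => ?_)
  have e := congrArg (Polynomial.eval ((x - β) / (2 * α))) (Chebyshev.U_add_two ℝ (j - 1))
  simp only [eval_mul, eval_sub, eval_X, eval_ofNat, sub_add_cancel,
    show j - 1 + 2 = j + 1 by ring] at e
  simp only [e]
  field_simp
  ring

/-- The semicircle law with centre `β` and radius `2 α`. -/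
def semicircleLaw {α : ℝ} (hα : 0 < α) (β : ℝ) : FiniteMeasure ℝ :=
  ⟨volume.withDensity fun x => ENNReal.ofReal (semicircleDensity α β x), by
    have hi := integrable_mul_semicircleDensity hα β (continuous_const (y := (1 : ℝ)))
    simp only [one_mul] at hi
    exact isFiniteMeasure_withDensity_ofReal hi.2⟩

theorem integral_semicircleLaw {α : ℝ} (hα : 0 < α) (β : ℝ) (f : ℝ → ℝ) :
    ∫ x, f x ∂(semicircleLaw hα β : Measure ℝ) = ∫ x, f x * semicircleDensity α β x := by
  rw [semicircleLaw, FiniteMeasure.toMeasure_mk, integral_withDensity_eq_integral_toReal_smul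
    (continuous_semicircleDensity α β).measurable.ennreal_ofReal (by simp)]
  refine integral_congr_ae (Filter.Eventually.of_forall fun x => ?_)
  simp only [ENNReal.toReal_ofReal (semicircleDensity_nonneg hα β x), smul_eq_mul, mul_comm]

theorem integrable_semicircleLaw {α : ℝ} (hα : 0 < α) (β : ℝ) {f : ℝ → ℝ} (hf : Continuous f) :
    Integrable f (semicircleLaw hα β : Measure ℝ) := by
  rw [semicircleLaw, FiniteMeasure.toMeasure_mk, integrable_withDensity_iff
    (continuous_semicircleDensity α β).measurable.ennreal_ofReal (by simp)]
  simp only [ENNReal.toReal_ofReal (semicircleDensity_nonneg hα β _)]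
  exact integrable_mul_semicircleDensity hα β hf

theorem semicircleLaw_real {α : ℝ} (hα : 0 < α) (β : ℝ) {s : Set ℝ} (hs : MeasurableSet s) :
    (semicircleLaw hα β : Measure ℝ).real s = ∫ x in s, semicircleDensity α β x := by
  have hi := integrable_mul_semicircleDensity hα β (continuous_const (y := (1 : ℝ)))
  simp only [one_mul] at hi
  have h0 := semicircleDensity_nonneg hα β
  rw [semicircleLaw, FiniteMeasure.toMeasure_mk, Measure.real, withDensity_apply _ hs,
    ← ofReal_integral_eq_lintegral_ofReal hi.integrableOn (Filter.Eventually.of_forall h0),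
    ENNReal.toReal_ofReal (integral_nonneg h0)]

theorem integral_pow_semicircleLaw {α : ℝ} (hα : 0 < α) (β : ℝ) (t : ℕ) :
    ∫ x, x ^ t ∂(semicircleLaw hα β : Measure ℝ) = semicircleMoment α β t 0 := by
  simp [integral_semicircleLaw, semicircleMoment]

/-! ### Functional calculus of a symmetric matrix -/

/-- Every function is continuous on the finite spectrum of a matrix. -/
theorem continuousOn_spectrum (B : Matrix n n ℝ) (f : ℝ → ℝ) : ContinuousOn f (spectrum ℝ B) :=
  B.finite_real_spectrum.continuousOn f

theorem cfc_mul_eq (B : Matrix n n ℝ) (f g : ℝ → ℝ) :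
    cfc f B * cfc g B = cfc (fun t => f t * g t) B :=
  (cfc_mul f g B (continuousOn_spectrum B f) (continuousOn_spectrum B g)).symm

theorem cfc_add_eq (B : Matrix n n ℝ) (f g : ℝ → ℝ) :
    cfc f B + cfc g B = cfc (fun t => f t + g t) B :=
  (cfc_add B f g (continuousOn_spectrum B f) (continuousOn_spectrum B g)).symm

theorem cfc_cfc_eq {B : Matrix n n ℝ} (hB : IsSelfAdjoint B) (f g : ℝ → ℝ) :
    cfc g (cfc f B) = cfc (fun t => g (f t)) B :=
  (cfc_comp' g f B ((B.finite_real_spectrum.image f).continuousOn g)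
    (continuousOn_spectrum B f) hB).symm

theorem inv_cfc {B : Matrix n n ℝ} (hB : IsSelfAdjoint B) {f : ℝ → ℝ}
    (hf : ∀ t ∈ spectrum ℝ B, f t ≠ 0) : (cfc f B)⁻¹ = cfc (fun t => (f t)⁻¹) B := by
  refine Matrix.inv_eq_left_inv ?_
  rw [cfc_mul_eq, ← cfc_const_one ℝ B hB]
  exact cfc_congr fun t ht => inv_mul_cancel₀ (hf t ht)

/-- If `A` is a positive function of `B`, then so is the explicit weight, and its value at an
eigenvalue `β` of `B` is the density of a semicircle law with centre `β`. -/
theorem duranWeight_cfc {B : Matrix n n ℝ} (hB : IsSelfAdjoint B) {φ : ℝ → ℝ}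
    (hφ : ∀ t ∈ spectrum ℝ B, 0 < φ t) (x : ℝ) :
    duranWeight (cfc φ B) B x = cfc (fun β => semicircleDensity (φ β) β x) B := by
  have hsub : B - x • (1 : Matrix n n ℝ) = cfc (fun t : ℝ => t - x) B := by
    rw [cfc_sub (fun t : ℝ => t) (fun _ => x) B, cfc_id' ℝ B hB, cfc_const x B hB,
      Algebra.algebraMap_eq_smul_one]
  have hfour : (4 : ℝ) • (1 : Matrix n n ℝ) = cfc (fun _ : ℝ => (4 : ℝ)) B := by
    rw [cfc_const (4 : ℝ) B hB, Algebra.algebraMap_eq_smul_one]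
  have hsq : invSqrt (cfc φ B) = cfc (fun t => (Real.sqrt (φ t))⁻¹) B := cfc_cfc_eq hB _ _
  rw [duranWeight, duranH, hsub, hfour, hsq, inv_cfc hB fun t ht => (hφ t ht).ne', cfc_mul_eq,
    cfc_mul_eq, cfc_mul_eq, cfc_mul_eq,
    ← cfc_sub _ _ B (continuousOn_spectrum B _) (continuousOn_spectrum B _), ← cfc_neg,
    cfc_cfc_eq hB, cfc_mul_eq, cfc_mul_eq,
    ← cfc_const_mul _ _ B (continuousOn_spectrum B _)]
  refine cfc_congr fun t ht => ?_
  have h0 := hφ t ht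
  have hs : (Real.sqrt (φ t))⁻¹ * (Real.sqrt (φ t))⁻¹ = (φ t)⁻¹ := by
    rw [← mul_inv, Real.mul_self_sqrt h0.le]
  have hH : -((Real.sqrt (φ t))⁻¹ * (t - x) * (φ t)⁻¹ * (t - x) * (Real.sqrt (φ t))⁻¹ - 4) =
      2 ^ 2 * (1 - ((x - t) / (2 * φ t)) ^ 2) := by
    have : (Real.sqrt (φ t))⁻¹ * (t - x) * (φ t)⁻¹ * (t - x) * (Real.sqrt (φ t))⁻¹ =
        ((Real.sqrt (φ t))⁻¹ * (Real.sqrt (φ t))⁻¹) * (t - x) * (φ t)⁻¹ * (t - x) := by ring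
    rw [this, hs]
    field_simp
    ring
  have hm : ∀ y : ℝ, max (2 ^ 2 * y) 0 = 2 ^ 2 * max y 0 := fun y => by
    rw [mul_max_of_nonneg _ _ (by norm_num), mul_zero]
  rw [hH, hm, Real.sqrt_mul (by norm_num), Real.sqrt_sq (by norm_num), semicircleDensity,
    mul_right_comm (Real.sqrt (φ t))⁻¹, hs]
  field_simp

/-- The absolute value depends only on the square. -/
theorem absMat_eq_cfc_sqrt {A : Matrix n n ℝ} (hA : IsSelfAdjoint A) :
    absMat A = cfc Real.sqrt (A * A) := by
  conv_rhs => rw [← cfc_id' ℝ A hA, cfc_mul_eq, cfc_cfc_eq hA]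
  exact cfc_congr fun t _ => (Real.sqrt_mul_self_eq_abs t).symm

theorem absMat_diagonal {c : n → ℝ} (hc : ∀ k, 0 ≤ c k) : absMat (diagonal c) = diagonal c := by
  have hsa : IsSelfAdjoint (diagonal c) := Matrix.isHermitian_diagonal c
  conv_rhs => rw [← cfc_id' ℝ (diagonal c) hsa]
  refine cfc_congr fun t ht => ?_
  rw [spectrum_diagonal] at ht
  obtain ⟨k, rfl⟩ := ht
  exact abs_of_nonneg (hc k)

theorem absMat_eq_diagonal {A : Matrix n n ℝ} (hA : IsSelfAdjoint A) {c : n → ℝ}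
    (hc : ∀ k, 0 ≤ c k) (h : A * A = diagonal fun k => c k ^ 2) : absMat A = diagonal c := by
  have hsa : IsSelfAdjoint (diagonal c) := Matrix.isHermitian_diagonal c
  rw [absMat_eq_cfc_sqrt hA, h, ← absMat_diagonal hc, absMat_eq_cfc_sqrt hsa,
    Matrix.diagonal_mul_diagonal]
  simp only [sq]

theorem absMat_of_posDef {A : Matrix n n ℝ} (hA : A.PosDef) : absMat A = A := by
  have hsa : IsSelfAdjoint A := hA.isHermitian
  conv_rhs => rw [← cfc_id' ℝ A hsa]
  refine cfc_congr fun t ht => ?_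
  rw [hA.isHermitian.spectrum_real_eq_range_eigenvalues] at ht
  obtain ⟨k, rfl⟩ := ht
  exact abs_of_pos (hA.eigenvalues_pos k)

/-! ### The explicit measure for commuting coefficients -/

section Commuting

variable {A B : Matrix n n ℝ} {φ : ℝ → ℝ}

/-- Let `A = J φ(B)` with an involution `J` that commutes with `B`, and `φ > 0`. The block Jacobi
matrix is conjugate to the one with `φ(B)` in place of `A` by the powers of `J`, and the latter
decomposes into scalar ones. -/
theorem jacobiPow_of_commute {J : Matrix n n ℝ} (hB : IsSelfAdjoint B)
    (hφ : ∀ t ∈ spectrum ℝ B, 0 < φ t) (hJ : J * J = 1) (hA : A = J * cfc φ B)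
    (hJB : Commute J B) (t j : ℕ) :
    jacobiPow A B t j 0 = J ^ j * cfc (fun β => semicircleMoment (φ β) β t j) B := by
  have hJc : ∀ f : ℝ → ℝ, Commute (cfc f B) J := fun f =>
    Commute.cfc (𝕜 := ℝ) hJB.symm (by rw [hB.star_eq]; exact hJB.symm) f
  have hJp : ∀ k, J ^ (k + 2) = J ^ k := fun k => by rw [pow_add, sq, hJ, mul_one]
  have hid : B = cfc (fun t : ℝ => t) B := (cfc_id' ℝ B hB).symm
  have hAJ : ∀ (k : ℕ) (f : ℝ → ℝ), A * (J ^ k * cfc f B) =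
      J ^ (k + 1) * cfc (fun β => φ β * f β) B := fun k f => by
    rw [hA, mul_assoc, ← mul_assoc (cfc φ B), ((hJc φ).pow_right k).eq, mul_assoc, cfc_mul_eq,
      ← mul_assoc, ← pow_succ']
  have hBJ : ∀ (k : ℕ) (f : ℝ → ℝ), B * (J ^ k * cfc f B) =
      J ^ k * cfc (fun β => β * f β) B := fun k f => by
    rw [← mul_assoc, ← (hJB.pow_left k).eq, mul_assoc]
    congr 1
    conv_lhs => enter [1]; rw [hid]
    exact cfc_mul_eq B _ f
  induction t generalizing j with
  | zero =>
    have h : cfc (fun β => semicircleMoment (φ β) β 0 j) B = if j = 0 then 1 else 0 := by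
      rw [cfc_congr (g := fun _ => if j = 0 then 1 else 0)
        fun β hβ => semicircleMoment_zero (hφ β hβ) β j]
      split_ifs
      · exact cfc_const_one ℝ B hB
      · exact cfc_const_zero ℝ B
    rw [jacobiPow, h]
    split_ifs with hj
    · simp [hj]
    · simp
  | succ t ih =>
    have hrec : cfc (fun β => semicircleMoment (φ β) β (t + 1) j) B =
        cfc (fun β => φ β * semicircleMoment (φ β) β t (j + 1)) B +
        cfc (fun β => β * semicircleMoment (φ β) β t j) B +
        cfc (fun β => φ β * semicircleMoment (φ β) β t (j - 1)) B := by
      rw [cfc_add_eq, cfc_add_eq]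
      exact cfc_congr fun β hβ => semicircleMoment_succ (hφ β hβ) β t j
    rw [hrec]
    rcases j with _ | j
    · rw [jacobiPow, ih, ih, hAJ, hBJ, hJp]
      simp [semicircleMoment_neg_one]
    · rw [jacobiPow, ih, ih, ih, hAJ, hBJ, hAJ, hJp]
      push_cast
      rw [mul_add, mul_add, add_sub_cancel_right, add_assoc (j : ℤ) 1 1]
      rfl

/-- If `|A|` is a positive function of `B` and `A` commutes with `B`, the explicit weight has the
required moments: it is the sum, over an orthonormal basis of eigenvectors `v` of `B`, of semicircle
laws times `v vᵀ`. -/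
theorem exists_matrixMeasure_of_commute (hB : B.IsHermitian)
    (hφ : ∀ t ∈ spectrum ℝ B, 0 < φ t) (hA : IsSelfAdjoint A) (habs : absMat A = cfc φ B)
    (hAB : Commute A B) :
    ∃ W : MatrixMeasure n, W.HasFiniteMoments ∧
      (∀ t, W.integral (X ^ t) 1 1 = jacobiPow A B t 0 0) ∧
      W.HasDensity (duranWeight (absMat A) B) := by
  have hmem : ∀ l, hB.eigenvalues l ∈ spectrum ℝ B := fun l => by
    rw [hB.spectrum_real_eq_range_eigenvalues]
    exact ⟨l, rfl⟩
  have hpos : ∀ l, 0 < φ (hB.eigenvalues l) := fun l => hφ _ (hmem l)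
  let μ : n → FiniteMeasure ℝ := fun l => semicircleLaw (hpos l) (hB.eigenvalues l)
  let c : n → Matrix n n ℝ := fun l =>
    Matrix.vecMulVec (hB.eigenvectorBasis l) (hB.eigenvectorBasis l)
  have hcfc : ∀ f : ℝ → ℝ, cfc f B = ∑ l, f (hB.eigenvalues l) • c l := fun f => by
    ext a b
    rw [cfc_apply_eq_sum hB, Matrix.sum_apply]
    rfl
  have hpow : ∀ l (k : ℕ), Integrable (fun x : ℝ => x ^ k) (μ l : Measure ℝ) := fun l k =>
    integrable_semicircleLaw (hpos l) _ (by fun_prop)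
  refine ⟨MatrixMeasure.ofMeasures c μ fun s _ => ?_,
    MatrixMeasure.hasFiniteMoments_ofMeasures hpow, fun t => ?_, fun a b => ⟨?_, fun s hs => ?_⟩⟩
  · refine Matrix.posSemidef_sum _ fun l _ => Matrix.PosSemidef.smul ?_ measureReal_nonneg
    simpa using! Matrix.posSemidef_vecMulVec_self_star (hB.eigenvectorBasis l).ofLp
  -- The involution is the sign `A |A|⁻¹` of `A`.
  · have hinv : cfc φ B * cfc (fun t => (φ t)⁻¹) B = 1 := by
      rw [cfc_mul_eq, ← cfc_const_one ℝ B hB]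
      exact cfc_congr fun t ht => mul_inv_cancel₀ (hφ t ht).ne'
    have hsq : A * A = cfc φ B * cfc φ B := by
      rw [← habs, absMat, cfc_mul_eq]
      conv_lhs => rw [← cfc_id' ℝ A hA, cfc_mul_eq]
      exact cfc_congr fun t _ => (abs_mul_abs_self t).symm
    have hcA : ∀ f : ℝ → ℝ, Commute (cfc f B) A := fun f =>
      Commute.cfc (𝕜 := ℝ) hAB.symm (by rw [hB.isSelfAdjoint.star_eq]; exact hAB.symm) f
    have hcB : ∀ f : ℝ → ℝ, Commute (cfc f B) B := fun f =>
      Commute.cfc (𝕜 := ℝ) (Commute.refl B)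
        (by rw [hB.isSelfAdjoint.star_eq]; exact Commute.refl B) f
    have hcc : cfc (fun t => (φ t)⁻¹) B * cfc φ B = 1 := by
      rw [(cfc_commute_cfc _ _ B).eq, hinv]
    have hmoment := jacobiPow_of_commute (A := A) (J := A * cfc (fun t => (φ t)⁻¹) B)
      hB.isSelfAdjoint hφ ?_ ?_ (hAB.mul_left (hcB _)) t 0
    · rw [hmoment, pow_zero, one_mul, hcfc, MatrixMeasure.integral_X_pow_ofMeasures hpow]
      exact Finset.sum_congr rfl fun l _ => by
        rw [integral_pow_semicircleLaw]
        rfl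
    · rw [mul_assoc, ← mul_assoc _ A, (hcA _).eq, mul_assoc, ← mul_assoc A, hsq, mul_assoc,
        ← mul_assoc (cfc φ B) (cfc _ B) (cfc _ B), hinv, one_mul, hinv]
    · rw [mul_assoc, hcc, mul_one]
  · rw [habs]
    simp only [duranWeight_cfc hB.isSelfAdjoint hφ, cfc_apply_eq_sum hB]
    refine integrable_finsetSum _ fun l _ => Integrable.mul_const ?_ _
    simpa using integrable_mul_semicircleDensity (hpos l) (hB.eigenvalues l)
      (continuous_const (y := (1 : ℝ)))
  · rw [habs, MatrixMeasure.ofMeasures_entry_apply hs]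
    simp only [duranWeight_cfc hB.isSelfAdjoint hφ, cfc_apply_eq_sum hB]
    have hi : ∀ l, Integrable (fun x => semicircleDensity (φ (hB.eigenvalues l))
        (hB.eigenvalues l) x) := fun l => by
      simpa using integrable_mul_semicircleDensity (hpos l) (hB.eigenvalues l)
        (continuous_const (y := (1 : ℝ)))
    rw [integral_finsetSum _ fun l _ => ((hi l).mul_const _).integrableOn]
    refine Finset.sum_congr rfl fun l _ => ?_
    rw [integral_mul_const, semicircleLaw_real (hpos l) _ hs]
    rfl

end Commuting

/-! ### Real parts of PQ-matrices -/

theorem isHermitian_of_isSymm {P : Matrix n n ℝ} (h : P.IsSymm) : P.IsHermitian :=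
  (Matrix.conjTranspose_eq_transpose_of_trivial P).trans h

/-- The column sums of the real part of `A`, which are the diagonal entries of `Aᴴ * A`. -/
def colSum (A : Matrix n n ℂ) (k : n) : ℝ :=
  ∑ i, realPart A i k

theorem colSum_nonneg (A : Matrix n n ℂ) (k : n) : 0 ≤ colSum A k :=
  Finset.sum_nonneg fun i _ => by rw [realPart_apply]; positivity

theorem ofReal_colSum (A : Matrix n n ℂ) (k : n) : (colSum A k : ℂ) = (Aᴴ * A) k k := by
  rw [colSum, Matrix.mul_apply, Complex.ofReal_sum]
  refine Finset.sum_congr rfl fun i _ => ?_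
  rw [realPart_apply, Matrix.conjTranspose_apply, Complex.ofReal_pow, ← Complex.conj_mul']
  rfl

theorem colSum_pos {A : Matrix n n ℂ} (hA : IsUnit A.det) (k : n) : 0 < colSum A k := by
  refine (colSum_nonneg A k).lt_of_ne' fun h => hA.ne_zero ?_
  refine Matrix.det_eq_zero_of_column_eq_zero k fun i => ?_
  have := (Finset.sum_eq_zero_iff_of_nonneg fun i _ => by rw [realPart_apply]; positivity).1 h i
    (Finset.mem_univ i)
  rw [realPart_apply] at this
  simpa using this

theorem two_mul_colSum_add_colSum {A B : Matrix n n ℂ}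
    (h : (2 : ℂ) • (Aᴴ * A) + Bᴴ * B = 1) (k : n) : 2 * colSum A k + colSum B k = 1 := by
  have hk := congrFun (congrFun h k) k
  rw [Matrix.add_apply, Matrix.smul_apply, ← ofReal_colSum, ← ofReal_colSum, Matrix.one_apply_eq,
    smul_eq_mul] at hk
  exact_mod_cast hk

/-- A symmetric real part of a PQ-matrix is a weighted involution, with weights the column sums. -/
theorem IsPQ.realPart_mul_self {A : Matrix n n ℂ} (hA : IsPQ A) (hs : (realPart A).IsSymm) :
    realPart A * realPart A = diagonal fun k => colSum A k ^ 2 := by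
  obtain ⟨σ, d, hσ⟩ := hA
  have h : ∀ k l, realPart A k l = if l = σ k then ‖d (σ k)‖ ^ 2 else 0 := fun k l => by
    rw [realPart_apply, hσ, permMatrix_mul_diagonal_apply]
    split_ifs <;> simp
  ext k l
  have hcol : colSum A k = ‖d (σ k)‖ ^ 2 := by
    simp only [colSum, hs.apply k, h, Finset.sum_ite_eq', Finset.mem_univ, if_true]
  have hT : ∑ m, realPart A k m * realPart A m l = ∑ m, realPart A k m * realPart A l m :=
    Finset.sum_congr rfl fun m _ => by rw [hs.apply l m]
  rw [Matrix.mul_apply, hT]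
  simp only [h, ite_mul, zero_mul, Finset.sum_ite_eq', Finset.mem_univ, if_true]
  by_cases hkl : k = l
  · subst hkl
    rw [if_pos rfl, Matrix.diagonal_apply_eq, hcol, sq (‖d (σ k)‖ ^ 2)]
  · rw [if_neg (fun e => hkl (σ.injective e)), mul_zero, Matrix.diagonal_apply_ne _ hkl]

theorem IsPQ.absMat_realPart {A : Matrix n n ℂ} (hA : IsPQ A) (hs : (realPart A).IsSymm) :
    absMat (realPart A) = diagonal (colSum A) :=
  absMat_eq_diagonal (isHermitian_of_isSymm hs) (colSum_nonneg A) (hA.realPart_mul_self hs)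

theorem isUnit_det_realPart {A : Matrix n n ℂ} (hA : IsPQ A) (hs : (realPart A).IsSymm)
    (hdet : IsUnit A.det) : IsUnit (realPart A).det := by
  have h := congrArg Matrix.det (hA.realPart_mul_self hs)
  rw [Matrix.det_mul, Matrix.det_diagonal] at h
  refine isUnit_iff_ne_zero.2 fun h0 => ?_
  rw [h0, zero_mul, eq_comm, Finset.prod_eq_zero_iff] at h
  obtain ⟨k, -, hk⟩ := h
  exact (colSum_pos hdet k).ne' (pow_eq_zero_iff two_ne_zero |>.1 hk)

/-- The normalization `2 Aᴴ A + Bᴴ B = I` makes `|P_A|` a function of `P_B`. -/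
theorem absMat_realPart_eq_cfc {A B : Matrix n n ℂ} (hA : IsPQ A) (hB : IsPQ B)
    (h : (2 : ℂ) • (Aᴴ * A) + Bᴴ * B = 1)
    (hAs : (realPart A).IsSymm) (hBs : (realPart B).IsSymm) :
    absMat (realPart A) = cfc (fun t : ℝ => 1 / 2 * (1 - |t|)) (realPart B) := by
  have hsa : IsSelfAdjoint (realPart B) := isHermitian_of_isSymm hBs
  have habs : cfc (fun t : ℝ => |t|) (realPart B) = diagonal (colSum B) :=
    hB.absMat_realPart hBs
  rw [hA.absMat_realPart hAs, cfc_const_mul _ _ _ (continuousOn_spectrum _ _),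
    cfc_sub _ _ _ (continuousOn_spectrum _ _) (continuousOn_spectrum _ _),
    cfc_const_one ℝ (realPart B) hsa, habs, ← Matrix.diagonal_one, Matrix.diagonal_sub,
    ← Matrix.diagonal_smul]
  congr 1
  funext k
  have := two_mul_colSum_add_colSum h k
  simp only [Pi.smul_apply, smul_eq_mul]
  linarith

/-- In dimension at most two, the real parts commute: if `P_A` is not diagonal, then both column
sums agree, for `A` and hence for `B`. -/
theorem commute_realPart_of_le_two {N : ℕ} (hN : N ≤ 2) {A B : Matrix (Fin N) (Fin N) ℂ}
    (hA : IsPQ A) (hB : IsPQ B) (h : (2 : ℂ) • (Aᴴ * A) + Bᴴ * B = 1)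
    (hAs : (realPart A).IsSymm) (hBs : (realPart B).IsSymm) :
    Commute (realPart A) (realPart B) := by
  have hP := hA.realPart_mul_self hAs
  have hQ := hB.realPart_mul_self hBs
  have hc := two_mul_colSum_add_colSum h
  have hP0 : ∀ i j, 0 ≤ realPart A i j := fun i j => by rw [realPart_apply]; positivity
  have hQ0 : ∀ i j, 0 ≤ realPart B i j := fun i j => by rw [realPart_apply]; positivity
  unfold colSum at hc hP hQ
  generalize realPart A = P at *
  generalize realPart B = Q at *
  interval_cases N
  · exact Subsingleton.elim _ _
  · ext i j
    simp [Matrix.mul_apply, Subsingleton.elim i 0, Subsingleton.elim j 0, mul_comm]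
  · have hP1 := congrFun (congrFun hP 0) 1
    have hQ1 := congrFun (congrFun hQ 0) 1
    have hc0 := hc 0
    have hc1 := hc 1
    have hPs := hAs.apply 0 1
    have hQs := hBs.apply 0 1
    simp only [Matrix.mul_apply, Fin.sum_univ_two, Matrix.diagonal_apply_ne _ (zero_ne_one)]
      at hP1 hQ1 hc0 hc1
    rw [hPs] at hc0
    rw [hQs] at hc0
    -- The off-diagonal entries of the two squares vanish, and all entries are nonnegative.
    have key : P 0 1 * (Q 0 0 - Q 1 1) = Q 0 1 * (P 0 0 - P 1 1) := by
      have e1 : P 0 1 = 0 ∨ P 0 0 + P 1 1 = 0 := by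
        rw [← mul_eq_zero]; linarith
      have e2 : Q 0 1 = 0 ∨ Q 0 0 + Q 1 1 = 0 := by
        rw [← mul_eq_zero]; linarith
      have p0 := hP0 0 0
      have p1 := hP0 1 1
      have q0 := hQ0 0 0
      have q1 := hQ0 1 1
      rcases e1 with e1 | e1
      · rcases e2 with e2 | e2
        · rw [e1, e2, zero_mul, zero_mul]
        · have : P 0 0 = P 1 1 := by linarith
          rw [e1, this, sub_self, zero_mul, mul_zero]
      · have a0 : P 0 0 = 0 := by linarith
        have a1 : P 1 1 = 0 := by linarith
        have : Q 0 0 = Q 1 1 := by linarith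
        rw [a0, a1, this, sub_self, mul_zero, sub_self, mul_zero]
    ext i j
    simp only [Matrix.mul_apply, Fin.sum_univ_two]
    fin_cases i <;> fin_cases j <;> simp only [Fin.zero_eta, Fin.mk_one, hPs, hQs] <;> linarith

/-! ### The explicit measure of the walk -/

/-- If the real parts commute, the explicit weight is an orthogonality measure. -/
theorem exists_matrixMeasure_of_commute_realPart {A B : Matrix n n ℂ} (hA : IsPQ A) (hB : IsPQ B)
    (h : (2 : ℂ) • (Aᴴ * A) + Bᴴ * B = 1) (hdet : IsUnit A.det)
    (hAs : (realPart A).IsSymm) (hBs : (realPart B).IsSymm)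
    (hcomm : Commute (realPart A) (realPart B)) :
    ∃ W : MatrixMeasure n, W.HasFiniteMoments ∧
      (∀ t, W.integral (X ^ t) 1 1 = jacobiPow (realPart A) (realPart B) t 0 0) ∧
      W.HasDensity (duranWeight (absMat (realPart A)) (realPart B)) := by
  have habs := absMat_realPart_eq_cfc hA hB h hAs hBs
  refine exists_matrixMeasure_of_commute (isHermitian_of_isSymm hBs) (fun t ht => ?_)
    (isHermitian_of_isSymm hAs) habs hcomm
  -- The values of the function on the spectrum of `P_B` are eigenvalues of the diagonal matrix
  -- `|P_A|`, that is, column sums of `P_A`.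
  have hs := cfc_map_spectrum (fun t : ℝ => 1 / 2 * (1 - |t|)) (realPart B)
    (isHermitian_of_isSymm hBs).isSelfAdjoint (continuousOn_spectrum _ _)
  rw [← habs, hA.absMat_realPart hAs, spectrum_diagonal] at hs
  obtain ⟨k, hk⟩ := hs.ge ⟨t, ht, rfl⟩
  exact (colSum_pos hdet k).trans_eq hk

end LazyOQW

end

theorem mainTheorem6 {N : ℕ} (A B : Matrix (Fin N) (Fin N) ℂ)
    (hA : LazyOQW.IsPQ A) (hB : LazyOQW.IsPQ B)
    (hnorm : (2 : ℂ) • (Aᴴ * A) + Bᴴ * B = 1)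
    (hAdet : IsUnit A.det)
    (hAsymm : (LazyOQW.realPart A).IsSymm) (hBsymm : (LazyOQW.realPart B).IsSymm) :
    ∃ W : LazyOQW.MatrixMeasure (Fin N),
      W.HasFiniteMoments ∧
      (∀ i j : ℕ,
        W.integral 1 (LazyOQW.chebU (LazyOQW.realPart A) (LazyOQW.realPart B) i)
            (LazyOQW.chebU (LazyOQW.realPart A) (LazyOQW.realPart B) j) =
          if i = j then 1 else 0) ∧
      (∀ (t i j : ℕ) (ρ : Matrix (Fin N) (Fin N) ℂ), ρ.PosSemidef → ρ.trace = 1 →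
        LazyOQW.transitionProb (LazyOQW.lazyTransition A B) ρ i j t =
          ∑ k, (((W.integral (Polynomial.X ^ t)
              (LazyOQW.chebU (LazyOQW.realPart A) (LazyOQW.realPart B) j)
              (LazyOQW.chebU (LazyOQW.realPart A) (LazyOQW.realPart B) i)).map
                (fun r : ℝ => (r : ℂ))) *ᵥ ρ.diag) k) ∧
      ((LazyOQW.realPart A).PosDef →
        W.HasDensity (LazyOQW.duranWeight (LazyOQW.realPart A) (LazyOQW.realPart B))) ∧
      ((N ≤ 2 ∨ Commute (LazyOQW.realPart A) (LazyOQW.realPart B)) →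
        W.HasDensity
          (LazyOQW.duranWeight (LazyOQW.absMat (LazyOQW.realPart A)) (LazyOQW.realPart B))) := by
  have hdet := LazyOQW.isUnit_det_realPart hA hAsymm hAdet
  have hpos : (LazyOQW.realPart A).PosDef →
      Commute (LazyOQW.realPart A) (LazyOQW.realPart B) := fun hp => by
    have h := LazyOQW.absMat_realPart_eq_cfc hA hB hnorm hAsymm hBsymm
    rw [LazyOQW.absMat_of_posDef hp] at h
    have hsa := (LazyOQW.isHermitian_of_isSymm hBsymm).isSelfAdjoint
    rw [h]
    exact Commute.cfc (𝕜 := ℝ) (Commute.refl _) (by rw [hsa.star_eq]; exact Commute.refl _) _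
  obtain ⟨W, hW, hmom, hdens⟩ : ∃ W : LazyOQW.MatrixMeasure (Fin N), W.HasFiniteMoments ∧
      (∀ t, W.integral (X ^ t) 1 1 =
        LazyOQW.jacobiPow (LazyOQW.realPart A) (LazyOQW.realPart B) t 0 0) ∧
      (Commute (LazyOQW.realPart A) (LazyOQW.realPart B) → W.HasDensity
        (LazyOQW.duranWeight (LazyOQW.absMat (LazyOQW.realPart A)) (LazyOQW.realPart B))) := by
    by_cases hc : Commute (LazyOQW.realPart A) (LazyOQW.realPart B)
    · obtain ⟨W, h1, h2, h3⟩ := LazyOQW.exists_matrixMeasure_of_commute_realPart hA hB hnorm hAdet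
        hAsymm hBsymm hc
      exact ⟨W, h1, h2, fun _ => h3⟩
    · obtain ⟨W, h1, h2⟩ := LazyOQW.exists_matrixMeasure_of_isSymm hAsymm hBsymm
      exact ⟨W, h1, h2, fun h => absurd h hc⟩
  have hU := hW.integral_chebU hdet hAsymm hBsymm hmom
  refine ⟨W, hW, fun i j => ?_, fun t i j ρ _ _ => ?_, fun hp => ?_, fun h => hdens ?_⟩
  · rw [← pow_zero (X : ℝ[X]), hU, LazyOQW.jacobiPow]
  · rw [LazyOQW.transitionProb_eq_sum_jacobiPow hA hB, hU]
  · have := hdens (hpos hp)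
    rwa [LazyOQW.absMat_of_posDef hp] at this
  · exact h.elim (fun hN => LazyOQW.commute_realPart_of_le_two hN hA hB hnorm hAsymm hBsymm) id
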